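/- Let $\phi_1,\phi_2,\dots$ be an orthonormal system in the real space $\mathbb L_2(0,1)$ with norm $\|\cdot\|$. For $\varepsilon>0$ and $S\in\mathbb L_2(0,1)$ one observes $dY_\varepsilon(t)=S(t)\,dt+\varepsilon\,dw(t)$, $t\in[0,1]$, with $w$ a Wiener process, through $y_{\varepsilon j}=\int_0^1\phi_j\,dY_\varepsilon=\theta_j+\varepsilon\xi_j$, $j\ge1$, where $\theta_j=\int_0^1 S\phi_j\,dt$ and $\xi_j$ are independent standard normal variables. For given numbers $\varkappa_{\varepsilon j}$ ($\varepsilon>0$, $j\ge1$) put $$\rho_\varepsilon^2=\sum_{j\ge1}\varkappa_{\varepsilon j}^2<\infty,\qquad A_\varepsilon=\varepsilon^{-4}\sum_{j\ge1}\varkappa_{\varepsilon j}^4,\qquad T_\varepsilon=\varepsilon^{-2}\sum_{j\ge1}\varkappa_{\varepsilon j}^2y_{\varepsilon j}^2-\rho_\varepsilon^2,$$ $$k_\varepsilon=\sup\Bigl\{k:\sum_{j<k}\varkappa_{\varepsilon j}^2\le\tfrac12\rho_\varepsilon^2\Bigr\},\qquad \varkappa_\varepsilon^2=\varkappa_{\varepsilon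 k_\varepsilon}^2 .$$ All asymptotic relations are as $\varepsilon\to0+$; for nonnegative functions, $a_\varepsilon\asymp b_\varepsilon$ means $cb_\varepsilon\le a_\varepsilon\le Cb_\varepsilon$ for some $c,C>0$ and all sufficiently small $\varepsilon>0$; $[a]$ is the integer part. Assume: A1. For every $\varepsilon>0$ the sequence $\varkappa_{\varepsilon j}^2$, $j\ge1$, is non-increasing. A2. There are $C_1,C_2>0$ with $C_1<A_\varepsilon<C_2$ for all $\varepsilon>0$. A3. There are $C_1>0$ and $\lambda>1$ such that $\varkappa^2_{\varepsilon,[(1+\delta)k_\varepsilon]}<C_1(1+\delta)^{-\lambda}\varkappa_\varepsilon^2$ for all $\delta>0$ and $\varepsilon>0$. A4. $\varkappa_{\varepsilon1}^2\asymp\varkappa_\varepsilon^2$, and for every $c>1$ there is $C>0$ with $\varkappa^2_{\varepsilon,[ck_\varepsilon]}\ge C\varkappa_\varepsilon^2$ for all $\varepsilon>0$. Let $0<r<1/2$, $0<2\omega<1-2r$ and $k_\varepsilon\asymp\varepsilon^{-4+8r+4\omega}$. For a test $L_\varepsilon=\mathbf 1\{A_\varepsilon^{-1/2}T_\varepsilon>x_\varepsilon\}$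 with critical value $x_\varepsilon\in\mathbb R$ let $\alpha(L_\varepsilon)=\mathbf P_0(A_\varepsilon^{-1/2}T_\varepsilon>x_\varepsilon)$ and $\beta(L_\varepsilon,S)=\mathbf P_S(A_\varepsilon^{-1/2}T_\varepsilon\le x_\varepsilon)$ be its type I and type II error probabilities. A family $S_\varepsilon\in\mathbb L_2(0,1)$, $\varepsilon>0$, is called $r_\varepsilon$-LD consistent if for every such family of tests with $\alpha(L_\varepsilon)\in(0,1)$ for all $\varepsilon>0$ and $r_\varepsilon^{-2}\log\alpha(L_\varepsilon)\to0$ there is $C>0$ with $r_\varepsilon^2\le C\,|\log\beta(L_\varepsilon,S_\varepsilon)|$ for all sufficiently small $\varepsilon>0$. Put $s=\dfrac{r}{2-4r-2\omega}$ and, for $P_0>0$, $$\bar{\mathbb B}^s_{2\infty}(P_0)=\Bigl\{S=\sum_{j\ge1}\theta_j\phi_j\in\mathbb L_2(0,1):\ \theta_j\in\mathbb R,\ \sup_{\lambda>0}\lambda^{2s}\sum_{j>\lambda}\theta_j^2\le P_0\Bigr\}.$$ **Theorem.** Let $S_\varepsilon\in\mathbb L_2(0,1)$, $\varepsilon>0$,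 satisfy $\|S_\varepsilon\|\asymp\varepsilon^{2r}$. Then the family $S_\varepsilon$ is $\varepsilon^{-2\omega}$-LD consistent if and only if there are $P_0>0$ and functions $S_{1\varepsilon}\in\bar{\mathbb B}^s_{2\infty}(P_0)$, $\varepsilon>0$, with $\|S_{1\varepsilon}\|\asymp\varepsilon^{2r}$, such that for every $\varepsilon>0$ the function $S_{1\varepsilon}$ is orthogonal to $S_\varepsilon-S_{1\varepsilon}$, i.e. $$\|S_\varepsilon\|^2=\|S_{1\varepsilon}\|^2+\|S_\varepsilon-S_{1\varepsilon}\|^2 .$$ -/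

import Mathlib

open MeasureTheory ProbabilityTheory Filter Topology Asymptotics

/-- The real Hilbert space `L₂(0,1)`. -/
abbrev L2Unit : Type := Lp ℝ 2 (volume.restrict (Set.Ioo (0 : ℝ) 1))

namespace WhiteNoise

noncomputable section

/-- The Fourier coefficient `θ_j = ∫₀¹ S φ_j dt`. -/
def coeff (φ : ℕ+ → L2Unit) (S : L2Unit) (j : ℕ+) : ℝ := inner ℝ (φ j) S

/-- The set `B̄^s_{2∞}(P₀)` of the `S = ∑ θ_j φ_j` with `sup_{l > 0} l^{2s} ∑_{j > l} θ_j² ≤ P₀`. -/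
def besovBall (φ : ℕ+ → L2Unit) (s P₀ : ℝ) : Set L2Unit :=
  {S | ∃ θ : ℕ+ → ℝ, HasSum (fun j => θ j • φ j) S ∧
    ∀ l : ℝ, 0 < l → l ^ (2 * s) * ∑' j : ℕ+, (if l < (j : ℝ) then θ j ^ 2 else 0) ≤ P₀}

/-- Law of a sequence `ξ₁, ξ₂, …` of independent standard normal variables. -/
def noise : Measure (ℕ+ → ℝ) := Measure.infinitePi fun _ => gaussianReal 0 1

/-- The observations `y_{εj} = θ_j + ε ξ_j`, that is `y_{εj} = ∫ φ_j dY_ε` for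
`dY_ε(t) = S(t) dt + ε dw(t)`. -/
def obs (φ : ℕ+ → L2Unit) (ε : ℝ) (S : L2Unit) (ξ : ℕ+ → ℝ) (j : ℕ+) : ℝ :=
  coeff φ S j + ε * ξ j

/-! The weights `ϰ_{εj}` are given as `w ε j` with `j ≥ 1`; the value `w ε 0` is never used. -/

/-- `ρ_ε² = ∑_{j ≥ 1} ϰ_{εj}²`. -/
def rhoSq (w : ℝ → ℕ → ℝ) (ε : ℝ) : ℝ := ∑' j : ℕ+, w ε j ^ 2

/-- `A_ε = ε⁻⁴ ∑_{j ≥ 1} ϰ_{εj}⁴`. -/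
def bigA (w : ℝ → ℕ → ℝ) (ε : ℝ) : ℝ := (ε ^ 4)⁻¹ * ∑' j : ℕ+, w ε j ^ 4

/-- `k_ε = sup {k : ∑_{1 ≤ j < k} ϰ_{εj}² ≤ ρ_ε² / 2}`. -/
def kIdx (w : ℝ → ℕ → ℝ) (ε : ℝ) : ℕ :=
  sSup {k : ℕ | ∑ j ∈ Finset.Ico 1 k, w ε j ^ 2 ≤ rhoSq w ε / 2}

/-- `ϰ_ε² = ϰ_{ε k_ε}²`. -/
def kappaSq (w : ℝ → ℕ → ℝ) (ε : ℝ) : ℝ := w ε (kIdx w ε) ^ 2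

/-- Conditions A1 - A4 on the weights. -/
structure Conditions (w : ℝ → ℕ → ℝ) : Prop where
  /-- `ρ_ε²` is finite. -/
  summable : ∀ ε > 0, Summable fun j : ℕ+ => w ε j ^ 2
  A1 : ∀ ε > 0, AntitoneOn (fun j : ℕ => w ε j ^ 2) (Set.Ici 1)
  A2 : ∃ C₁ > 0, ∃ C₂ > 0, ∀ ε > 0, C₁ < bigA w ε ∧ bigA w ε < C₂
  A3 : ∃ C₁ > 0, ∃ lam > 1, ∀ δ > 0, ∀ ε > 0,
    w ε ⌊(1 + δ) * (kIdx w ε : ℝ)⌋₊ ^ 2 < C₁ * (1 + δ) ^ (-lam : ℝ) * kappaSq w ε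
  A4_first : (fun ε => w ε 1 ^ 2) =Θ[𝓝[>] 0] kappaSq w
  A4_tail : ∀ c : ℝ, 1 < c → ∃ C > 0, ∀ ε > 0,
    C * kappaSq w ε ≤ w ε ⌊c * (kIdx w ε : ℝ)⌋₊ ^ 2

/-- The statistic `T_ε(y) = ε⁻² ∑_{j ≥ 1} ϰ_{εj}² y_j² - ρ_ε²`. -/
def stat (w : ℝ → ℕ → ℝ) (ε : ℝ) (y : ℕ+ → ℝ) : ℝ :=
  (ε ^ 2)⁻¹ * (∑' j : ℕ+, w ε j ^ 2 * y j ^ 2) - rhoSq w ε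

/-- The rejection region of the test `L_ε = 1{A_ε^{-1/2} T_ε > x}`. -/
def rejection (w : ℝ → ℕ → ℝ) (ε x : ℝ) : Set (ℕ+ → ℝ) :=
  {y | x < (Real.sqrt (bigA w ε))⁻¹ * stat w ε y}

/-- The type I error probability of the test with critical value `x`. -/
def typeI (φ : ℕ+ → L2Unit) (w : ℝ → ℕ → ℝ) (ε x : ℝ) : ℝ :=
  noise.real {ξ | obs φ ε 0 ξ ∈ rejection w ε x}

/-- The type II error probability, at the alternative `S`, of the test with critical value `x`. -/
def typeII (φ : ℕ+ → L2Unit) (w : ℝ → ℕ → ℝ) (ε x : ℝ) (S : L2Unit) : ℝ :=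
  noise.real {ξ | obs φ ε S ξ ∉ rejection w ε x}

/-- `R_ε`-LD consistency of the family `S_ε` for the tests generated by `T_ε`: for all tests
`L_ε = 1{A_ε^{-1/2} T_ε > x_ε}` of levels `α_ε ∈ (0,1)` with `R_ε⁻² log α(L_ε) → 0` there is `C`
with `R_ε² ≤ C |log β(L_ε, S_ε)|` for all small `ε > 0`.
(`α < 1` only leaves out tests that always reject; for these `β = 0`.) -/
def LDConsistent (φ : ℕ+ → L2Unit) (w : ℝ → ℕ → ℝ) (R : ℝ → ℝ) (S : ℝ → L2Unit) : Prop :=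
  ∀ x : ℝ → ℝ,
    (∀ ε > 0, 0 < typeI φ w ε (x ε) ∧ typeI φ w ε (x ε) < 1) →
    Tendsto (fun ε => (R ε ^ 2)⁻¹ * Real.log (typeI φ w ε (x ε))) (𝓝[>] 0) (𝓝 0) →
    (fun ε => R ε ^ 2) =O[𝓝[>] 0] fun ε => Real.log (typeII φ w ε (x ε) (S ε))

end

end WhiteNoise

/-! Put `u_j = ϰ_{εj}² / ε²` and `z_j = θ_j / ε`. Up to scaling and centring, the statistic is the
quadratic form `Q = ∑ u_j (z_j + ξ_j)²`, and `A_ε = ∑ u_j²` stays between two positive constants.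
The proof reduces the stochastic statement to a deterministic one about the signal `D = ∑ u_j z_j²`,
and then reads that off the coefficients.

Stochastic half (`consistent_iff_signal`): if `R → ∞` and `u_1 R → 0`, consistency holds exactly
when `D ≥ c R` for small `ε`. The exponential moments of `Q` are explicit, and parameters `t` of
order `R` are admissible because `u_1 R → 0`. Chernoff's bound shows that `log α = o(R²)` keeps the
centred threshold below any `δ R`, and then a signal `D ≥ c R` gives `log β ≤ -c' R²`. Conversely,
if `D / R` is arbitrarily small along some `ε → 0`, a threshold of order `1 + D` has `log α =
o(R²)`, by a Paley–Zygmund lower bound on the tail, but leaves `β ≥ 1/2` there.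

Deterministic half: since `A_ε ≍ 1`, the weights `ϰ_{ε1}²` and `ϰ_ε²` both have order `E` with `E²
k_ε ≍ ε⁴`, and `D ≥ c R` means `∑ ϰ_{εj}² θ_j² ≥ c E X²`, where `X = ε^{2r}`. By A3 the frequencies
beyond `B k_ε` contribute little for large `B`, so the projection of `S` on the first `[B k_ε]`
functions has norm of order `X`. It lies in a fixed ball because `k_ε^{2s} X² ≍ 1`, which is what
determines `s` (`exists_decomposition_of_signal`). Conversely, a component in the ball has little
energy beyond `B k_ε`; orthogonality gives `‖S₁‖² = ⟨S₁, S⟩`, so `S` itself has energy of order `X²`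
below `B k_ε`, where by A4 the weights are of order `E` (`exists_signal_of_decomposition`). -/

namespace WhiteNoise

/-! ### Exponential moments of a squared Gaussian variable -/

/-- The quadratic form `∑ u_j (z_j + ξ_j)²`. -/
noncomputable def quad (u z ξ : ℕ+ → ℝ) : ℝ := ∑' j, u j * (z j + ξ j) ^ 2

/-- The logarithm of `E exp (a (z + ξ)²)` for a standard normal `ξ` and `a < 1 / 2`. -/
noncomputable def logMGF (a z : ℝ) : ℝ := a * z ^ 2 / (1 - 2 * a) - Real.log (1 - 2 * a) / 2

/-- Completing the square turns the tilted density into a multiple of the Gaussian density with mean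
`2az / (1 - 2a)` and variance `1 / (1 - 2a)`. -/
theorem lintegral_exp_mul_sq_gaussianReal {a : ℝ} (ha : a < 1 / 2) (z : ℝ) :
    ∫⁻ x, ENNReal.ofReal (Real.exp (a * (z + x) ^ 2)) ∂gaussianReal 0 1 =
      ENNReal.ofReal (Real.exp (logMGF a z)) := by
  have hb : 0 < 1 - 2 * a := by linarith
  have hv : (Real.toNNReal (1 - 2 * a)⁻¹) ≠ 0 := by
    simpa using hb
  have hvc : ((Real.toNNReal (1 - 2 * a)⁻¹ : NNReal) : ℝ) = (1 - 2 * a)⁻¹ :=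
    Real.coe_toNNReal _ (by positivity)
  have key : ∀ x : ℝ, gaussianPDF 0 1 x * ENNReal.ofReal (Real.exp (a * (z + x) ^ 2)) =
      ENNReal.ofReal (Real.exp (logMGF a z)) *
        gaussianPDF (2 * a * z / (1 - 2 * a)) (Real.toNNReal (1 - 2 * a)⁻¹) x := by
    intro x
    rw [gaussianPDF, gaussianPDF, ← ENNReal.ofReal_mul (gaussianPDFReal_nonneg _ _ _),
      ← ENNReal.ofReal_mul (Real.exp_pos _).le]
    congr 1
    rw [gaussianPDFReal, gaussianPDFReal, hvc]
    have hs : (√(2 * Real.pi * (1 - 2 * a)⁻¹))⁻¹ =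
        (√(2 * Real.pi * ((1 : NNReal) : ℝ)))⁻¹ * Real.exp (Real.log (1 - 2 * a) / 2) := by
      rw [NNReal.coe_one, mul_one, Real.sqrt_mul (by positivity), mul_inv, Real.sqrt_inv, inv_inv,
        Real.exp_half, Real.exp_log hb]
    rw [hs, mul_comm (Real.exp (logMGF a z)), mul_assoc (_ : ℝ)⁻¹, ← Real.exp_add,
      mul_assoc (_ : ℝ)⁻¹, ← Real.exp_add, mul_assoc (_ : ℝ)⁻¹, ← Real.exp_add]
    congr 2
    rw [logMGF]
    simp only [NNReal.coe_one]
    field_simp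
    ring
  rw [gaussianReal_of_var_ne_zero _ one_ne_zero,
    lintegral_withDensity_eq_lintegral_mul _ (measurable_gaussianPDF _ _) (by fun_prop)]
  simp only [Pi.mul_apply, key]
  rw [lintegral_const_mul _ (measurable_gaussianPDF _ _), lintegral_gaussianPDF_eq_one _ hv,
    mul_one]

/-- In this and the next two bounds the linear term in `a` sums to the centring `∑ u_j`, the square
to `A_ε`, and the term with `z` to the signal. -/
theorem logMGF_le {a : ℝ} (ha₀ : 0 ≤ a) (ha : a ≤ 1 / 4) (z : ℝ) :
    logMGF a z ≤ a + 4 * a ^ 2 + 2 * (a * z ^ 2) := by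
  have hb : 0 < 1 - 2 * a := by linarith
  have h1 : a * z ^ 2 / (1 - 2 * a) ≤ 2 * (a * z ^ 2) := by
    rw [div_le_iff₀ hb]
    nlinarith [mul_nonneg ha₀ (sq_nonneg z)]
  have h2 : -Real.log (1 - 2 * a) ≤ 2 * a + 8 * a ^ 2 := by
    rw [← Real.log_inv]
    refine (Real.log_le_sub_one_of_pos (by positivity)).trans ?_
    rw [inv_eq_one_div, sub_le_iff_le_add, div_le_iff₀ hb]
    nlinarith [pow_nonneg ha₀ 2]
  rw [logMGF]
  linarith

theorem le_logMGF_zero {a : ℝ} (ha₀ : 0 ≤ a) (ha : a < 1 / 2) : a + a ^ 2 ≤ logMGF a 0 := by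
  have hb : 0 < 1 - 2 * a := by linarith
  have h := Real.le_log_one_add_of_nonneg (x := 2 * a / (1 - 2 * a)) (by positivity)
  have h1 : 1 + 2 * a / (1 - 2 * a) = (1 - 2 * a)⁻¹ := by field_simp; ring
  have h2 : 2 * (2 * a / (1 - 2 * a)) / (2 * a / (1 - 2 * a) + 2) = 2 * a / (1 - a) := by
    have : 1 - a ≠ 0 := by linarith
    have : 2 * a + (1 - 2 * a) * 2 ≠ 0 := by linarith
    field_simp
    ring
  rw [h1, h2, Real.log_inv] at h
  have h3 : 2 * a + 2 * a ^ 2 ≤ 2 * a / (1 - a) := by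
    rw [le_div_iff₀ (by linarith)]
    nlinarith [pow_nonneg ha₀ 3]
  rw [logMGF]
  simp only [ne_eq, OfNat.ofNat_ne_zero, not_false_eq_true, zero_pow, mul_zero, zero_div]
  linarith

theorem logMGF_neg_le {a : ℝ} (ha₀ : 0 ≤ a) (ha : a ≤ 1 / 2) (z : ℝ) :
    logMGF (-a) z ≤ -a + a ^ 2 - a * z ^ 2 / 2 := by
  have h1 : a * z ^ 2 / 2 ≤ a * z ^ 2 / (1 + 2 * a) :=
    div_le_div_of_nonneg_left (by positivity) (by linarith) (by linarith)
  have h2 := Real.le_log_one_add_of_nonneg (x := 2 * a) (by positivity)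
  have h3 : 2 * a - 2 * a ^ 2 ≤ 2 * (2 * a) / (2 * a + 2) := by
    rw [le_div_iff₀ (by linarith)]
    nlinarith [pow_nonneg ha₀ 3]
  rw [logMGF, mul_neg, sub_neg_eq_add, neg_mul, neg_div]
  linarith

/-! ### Convergence and Laplace transform of the quadratic form -/

instance : IsProbabilityMeasure noise := by
  unfold noise
  infer_instance

/-- A divergent real series has the default sum `0`, and so does `toReal` of an infinite sum in
`ENNReal`; hence the two expressions agree everywhere, not only almost surely. -/
theorem measurable_quad (u z : ℕ+ → ℝ) (hu : ∀ j, 0 ≤ u j) : Measurable (quad u z) := by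
  have h : quad u z = fun ξ => (∑' j, ENNReal.ofReal (u j * (z j + ξ j) ^ 2)).toReal := by
    funext ξ
    rw [ENNReal.tsum_toReal_eq (fun _ => ENNReal.ofReal_ne_top)]
    refine tsum_congr fun j => (ENNReal.toReal_ofReal ?_).symm
    exact mul_nonneg (hu j) (sq_nonneg _)
  rw [h]
  refine (Measurable.tsum fun j => ?_).ennreal_toReal
  fun_prop

/-- The series of expectations converges, because `(z + ξ)² ≤ 2 z² + 2 ξ²`. -/
theorem ae_summable_quad {u z : ℕ+ → ℝ} (hu₀ : ∀ j, 0 ≤ u j) (hu : Summable u)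
    (hz : Summable fun j => u j * z j ^ 2) :
    ∀ᵐ ξ ∂noise, Summable fun j => u j * (z j + ξ j) ^ 2 := by
  have hc : Integrable (fun x : ℝ => x ^ 2) (gaussianReal 0 1) :=
    (memLp_id_gaussianReal 2).integrable_sq
  have hterm : ∀ j, ∫⁻ ξ : ℕ+ → ℝ, ENNReal.ofReal (u j * (z j + ξ j) ^ 2) ∂noise ≤
      ENNReal.ofReal (2 * (u j * z j ^ 2) + 2 * (∫ x, x ^ 2 ∂gaussianReal 0 1) * u j) := by
    intro j
    have hm := (measurePreserving_eval_infinitePi (fun _ : ℕ+ => gaussianReal 0 1) j)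
    have h1 : ∫⁻ ξ : ℕ+ → ℝ, ENNReal.ofReal (u j * (z j + ξ j) ^ 2) ∂noise =
        ∫⁻ x, ENNReal.ofReal (u j * (z j + x) ^ 2) ∂gaussianReal 0 1 :=
      hm.lintegral_comp (f := fun x => ENNReal.ofReal (u j * (z j + x) ^ 2)) (by fun_prop)
    rw [h1]
    have hi : Integrable (fun x : ℝ => 2 * (u j * z j ^ 2) + 2 * x ^ 2 * u j)
        (gaussianReal 0 1) := (integrable_const _).add ((hc.const_mul 2).mul_const _)
    calc _ ≤ ∫⁻ x, ENNReal.ofReal (2 * (u j * z j ^ 2) + 2 * x ^ 2 * u j) ∂gaussianReal 0 1 := by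
          refine lintegral_mono fun x => ENNReal.ofReal_le_ofReal ?_
          nlinarith [mul_nonneg (hu₀ j) (sq_nonneg (z j - x))]
      _ = _ := by
          rw [← ofReal_integral_eq_lintegral_ofReal hi (ae_of_all _ fun x => ?_)]
          · congr 1
            rw [integral_add (integrable_const _) ((hc.const_mul 2).mul_const _),
              integral_mul_const _ (fun x : ℝ => 2 * x ^ 2), integral_const_mul]
            simp [integral_const_mul]
          · have := hu₀ j
            positivity
  have hmeas : ∀ j, Measurable fun ξ : ℕ+ → ℝ => ENNReal.ofReal (u j * (z j + ξ j) ^ 2) :=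
    fun j => by fun_prop
  have hfin : ∫⁻ ξ : ℕ+ → ℝ, ∑' j, ENNReal.ofReal (u j * (z j + ξ j) ^ 2) ∂noise ≠ ⊤ := by
    rw [lintegral_tsum fun j => (hmeas j).aemeasurable]
    exact ne_top_of_le_ne_top ((hz.mul_left 2).add (hu.mul_left _)).tsum_ofReal_ne_top
      (ENNReal.tsum_le_tsum hterm)
  filter_upwards [ae_lt_top (Measurable.tsum hmeas) hfin] with ξ hξ
  have := ENNReal.summable_toReal hξ.ne
  refine this.congr fun j => ?_
  exact ENNReal.toReal_ofReal (mul_nonneg (hu₀ j) (sq_nonneg _))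

theorem lintegral_exp_sum {u z : ℕ+ → ℝ} {t : ℝ} (s : Finset ℕ+) (h : ∀ j, t * u j < 1 / 2) :
    ∫⁻ ξ, ENNReal.ofReal (Real.exp (t * ∑ j ∈ s, u j * (z j + ξ j) ^ 2)) ∂noise =
      ENNReal.ofReal (Real.exp (∑ j ∈ s, logMGF (t * u j) (z j))) := by
  have h1 : ∀ ξ : ℕ+ → ℝ, ENNReal.ofReal (Real.exp (t * ∑ j ∈ s, u j * (z j + ξ j) ^ 2)) =
      ∏ j ∈ s, ENNReal.ofReal (Real.exp (t * u j * (z j + ξ j) ^ 2)) := by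
    intro ξ
    rw [← ENNReal.ofReal_prod_of_nonneg (fun _ _ => (Real.exp_pos _).le), ← Real.exp_sum,
      Finset.mul_sum]
    simp only [mul_assoc]
  simp only [h1]
  have hind : iIndepFun (fun (j : ℕ+) (ξ : ℕ+ → ℝ) =>
      ENNReal.ofReal (Real.exp (t * u j * (z j + ξ j) ^ 2))) noise :=
    iIndepFun_infinitePi (P := fun _ : ℕ+ => gaussianReal 0 1)
      (X := fun j x => ENNReal.ofReal (Real.exp (t * u j * (z j + x) ^ 2)))
      (fun j => by fun_prop)
  rw [lintegral_prod_eq_prod_lintegral_of_indepFun s _ hind (fun j => by fun_prop),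
    Real.exp_sum, ENNReal.ofReal_prod_of_nonneg (fun _ _ => (Real.exp_pos _).le)]
  refine Finset.prod_congr rfl fun j _ => ?_
  rw [← lintegral_exp_mul_sq_gaussianReal (h j)]
  exact (measurePreserving_eval_infinitePi (fun _ : ℕ+ => gaussianReal 0 1) j).lintegral_comp
    (f := fun x => ENNReal.ofReal (Real.exp (t * u j * (z j + x) ^ 2))) (by fun_prop)

section bounds

variable {u z : ℕ+ → ℝ} (hu₀ : ∀ j, 0 ≤ u j) (hu : Summable u)
  (hz : Summable fun j => u j * z j ^ 2)

theorem summable_sq_of_summable {u : ℕ+ → ℝ} (hu₀ : ∀ j, 0 ≤ u j) (hu : Summable u) :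
    Summable fun j => u j ^ 2 := by
  have h := (hu.tendsto_cofinite_zero).eventually (eventually_le_nhds (zero_lt_one (α := ℝ)))
  refine Summable.of_norm_bounded_eventually hu ?_
  filter_upwards [h] with j hj
  rw [Real.norm_of_nonneg (sq_nonneg _), sq]
  exact mul_le_of_le_one_left (hu₀ j) hj

-- Fatou's lemma carries bounds on finite sums to the series. It needs a sequence, hence the choice
-- of a sequence of finite sets tending to infinity.
include hu₀ hu hz in
theorem lintegral_exp_quad_le_of_forall {t B : ℝ} (ht : ∀ j, t * u j < 1 / 2)
    (hB : ∀ s : Finset ℕ+, ∑ j ∈ s, logMGF (t * u j) (z j) ≤ B) :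
    ∫⁻ ξ, ENNReal.ofReal (Real.exp (t * quad u z ξ)) ∂noise ≤ ENNReal.ofReal (Real.exp B) := by
  obtain ⟨s, hs⟩ := (atTop : Filter (Finset ℕ+)).exists_seq_tendsto
  have h1 : ∫⁻ ξ, ENNReal.ofReal (Real.exp (t * quad u z ξ)) ∂noise =
      ∫⁻ ξ, liminf (fun n => ENNReal.ofReal
        (Real.exp (t * ∑ j ∈ s n, u j * (z j + ξ j) ^ 2))) atTop ∂noise := by
    refine lintegral_congr_ae ?_
    filter_upwards [ae_summable_quad hu₀ hu hz] with ξ hξ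
    refine (Tendsto.liminf_eq ?_).symm
    refine ENNReal.tendsto_ofReal ((Real.continuous_exp.tendsto _).comp ?_)
    exact (hξ.hasSum.comp hs).const_mul t
  rw [h1]
  refine (lintegral_liminf_le fun n => by fun_prop).trans ?_
  refine liminf_le_of_le (by isBoundedDefault) fun b hb => ?_
  obtain ⟨n, hn⟩ := hb.exists
  refine hn.trans ?_
  rw [lintegral_exp_sum _ ht]
  exact ENNReal.ofReal_le_ofReal (Real.exp_le_exp.2 (hB _))

include hu₀ hu hz in
theorem lintegral_exp_quad_le {t : ℝ} (ht₀ : 0 ≤ t) (ht : ∀ j, t * u j ≤ 1 / 4) :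
    ∫⁻ ξ, ENNReal.ofReal (Real.exp (t * quad u z ξ)) ∂noise ≤
      ENNReal.ofReal (Real.exp (t * ∑' j, u j + 4 * t ^ 2 * ∑' j, u j ^ 2 +
        2 * t * ∑' j, u j * z j ^ 2)) := by
  refine lintegral_exp_quad_le_of_forall hu₀ hu hz (fun j => by linarith [ht j]) fun s => ?_
  have h2 := summable_sq_of_summable hu₀ hu
  calc ∑ j ∈ s, logMGF (t * u j) (z j)
      ≤ ∑ j ∈ s, (t * u j + 4 * t ^ 2 * u j ^ 2 + 2 * t * (u j * z j ^ 2)) := by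
        refine Finset.sum_le_sum fun j _ => ?_
        refine (logMGF_le (mul_nonneg ht₀ (hu₀ j)) (ht j) (z j)).trans_eq (by ring)
    _ ≤ ∑' j, (t * u j + 4 * t ^ 2 * u j ^ 2 + 2 * t * (u j * z j ^ 2)) := by
        refine Summable.sum_le_tsum s (fun j _ => ?_)
          (((hu.mul_left _).add (h2.mul_left _)).add (hz.mul_left _))
        have := hu₀ j
        positivity
    _ = _ := by
        rw [Summable.tsum_add ((hu.mul_left _).add (h2.mul_left _)) (hz.mul_left _),
          Summable.tsum_add (hu.mul_left _) (h2.mul_left _), tsum_mul_left, tsum_mul_left,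
          tsum_mul_left]

include hu₀ hu in
theorem le_lintegral_exp_quad {t : ℝ} (ht₀ : 0 ≤ t) (ht : ∀ j, t * u j < 1 / 2) :
    ENNReal.ofReal (Real.exp (t * ∑' j, u j + t ^ 2 * ∑' j, u j ^ 2)) ≤
      ∫⁻ ξ, ENNReal.ofReal (Real.exp (t * quad u 0 ξ)) ∂noise := by
  have h2 := summable_sq_of_summable hu₀ hu
  have hsum : HasSum (fun j => t * u j + t ^ 2 * u j ^ 2)
      (t * ∑' j, u j + t ^ 2 * ∑' j, u j ^ 2) :=
    (hu.hasSum.mul_left _).add (h2.hasSum.mul_left _)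
  have hlim : Tendsto (fun s : Finset ℕ+ => ENNReal.ofReal
      (Real.exp (∑ j ∈ s, (t * u j + t ^ 2 * u j ^ 2)))) atTop
      (𝓝 (ENNReal.ofReal (Real.exp (t * ∑' j, u j + t ^ 2 * ∑' j, u j ^ 2)))) :=
    ENNReal.tendsto_ofReal ((Real.continuous_exp.tendsto _).comp hsum)
  refine le_of_tendsto' hlim fun s => ?_
  calc _ ≤ ENNReal.ofReal (Real.exp (∑ j ∈ s, logMGF (t * u j) ((0 : ℕ+ → ℝ) j))) := by
        refine ENNReal.ofReal_le_ofReal (Real.exp_le_exp.2 (Finset.sum_le_sum fun j _ => ?_))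
        rw [← mul_pow]
        exact le_logMGF_zero (mul_nonneg ht₀ (hu₀ j)) (ht j)
    _ = ∫⁻ ξ, ENNReal.ofReal (Real.exp (t * ∑ j ∈ s, u j * ((0 : ℕ+ → ℝ) j + ξ j) ^ 2)) ∂noise :=
        (lintegral_exp_sum s ht).symm
    _ ≤ _ := by
        refine lintegral_mono_ae ?_
        filter_upwards [ae_summable_quad (z := 0) hu₀ hu (by simp)] with ξ hξ
        refine ENNReal.ofReal_le_ofReal (Real.exp_le_exp.2 (mul_le_mul_of_nonneg_left ?_ ht₀))
        exact hξ.sum_le_tsum s fun j _ => mul_nonneg (hu₀ j) (sq_nonneg _)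

-- Dropping terms of the form only increases `exp (-t Q)`, so every finite set gives an upper bound,
-- and the exponents of these bounds converge.
include hu₀ hu hz in
theorem lintegral_exp_neg_quad_le {t : ℝ} (ht₀ : 0 ≤ t) (ht : ∀ j, t * u j ≤ 1 / 2) :
    ∫⁻ ξ, ENNReal.ofReal (Real.exp (-t * quad u z ξ)) ∂noise ≤
      ENNReal.ofReal (Real.exp (-t * ∑' j, u j + t ^ 2 * ∑' j, u j ^ 2 -
        t / 2 * ∑' j, u j * z j ^ 2)) := by
  have h2 := summable_sq_of_summable hu₀ hu
  have hsum : HasSum (fun j => -t * u j + t ^ 2 * u j ^ 2 - t / 2 * (u j * z j ^ 2))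
      (-t * ∑' j, u j + t ^ 2 * ∑' j, u j ^ 2 - t / 2 * ∑' j, u j * z j ^ 2) :=
    ((hu.hasSum.mul_left _).add (h2.hasSum.mul_left _)).sub (hz.hasSum.mul_left _)
  have hlim : Tendsto (fun s : Finset ℕ+ => ENNReal.ofReal
      (Real.exp (∑ j ∈ s, (-t * u j + t ^ 2 * u j ^ 2 - t / 2 * (u j * z j ^ 2))))) atTop
      (𝓝 (ENNReal.ofReal (Real.exp (-t * ∑' j, u j + t ^ 2 * ∑' j, u j ^ 2 -
        t / 2 * ∑' j, u j * z j ^ 2)))) :=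
    ENNReal.tendsto_ofReal ((Real.continuous_exp.tendsto _).comp hsum)
  refine ge_of_tendsto' hlim fun s => ?_
  calc _ ≤ ∫⁻ ξ, ENNReal.ofReal (Real.exp (-t * ∑ j ∈ s, u j * (z j + ξ j) ^ 2)) ∂noise := by
        refine lintegral_mono_ae ?_
        filter_upwards [ae_summable_quad hu₀ hu hz] with ξ hξ
        refine ENNReal.ofReal_le_ofReal (Real.exp_le_exp.2
          (mul_le_mul_of_nonpos_left ?_ (neg_nonpos.2 ht₀)))
        exact hξ.sum_le_tsum s fun j _ => mul_nonneg (hu₀ j) (sq_nonneg _)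
    _ = ENNReal.ofReal (Real.exp (∑ j ∈ s, logMGF (-t * u j) (z j))) :=
        lintegral_exp_sum s fun j => by
          have := mul_nonneg ht₀ (hu₀ j)
          linarith
    _ ≤ _ := by
        refine ENNReal.ofReal_le_ofReal (Real.exp_le_exp.2 (Finset.sum_le_sum fun j _ => ?_))
        rw [neg_mul]
        refine (logMGF_neg_le (mul_nonneg ht₀ (hu₀ j)) (ht j) (z j)).trans_eq (by ring)

/-! ### Chernoff upper bounds and Paley–Zygmund lower bounds -/

/-- Markov's inequality for the exponential of a random variable. -/
theorem measureReal_le_exp_of_lintegral_exp_le {X : (ℕ+ → ℝ) → ℝ} {B c : ℝ}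
    (hX : Measurable X)
    (h : ∫⁻ ξ, ENNReal.ofReal (Real.exp (X ξ)) ∂noise ≤ ENNReal.ofReal (Real.exp B)) :
    noise.real {ξ | c ≤ X ξ} ≤ Real.exp (B - c) := by
  have hm := mul_meas_ge_le_lintegral (μ := noise)
    (f := fun ξ => ENNReal.ofReal (Real.exp (X ξ))) (by fun_prop) (ENNReal.ofReal (Real.exp c))
  have hset : {ξ | ENNReal.ofReal (Real.exp c) ≤ ENNReal.ofReal (Real.exp (X ξ))} =
      {ξ | c ≤ X ξ} := by
    ext ξ
    simp [ENNReal.ofReal_le_ofReal_iff (Real.exp_pos _).le]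
  rw [hset] at hm
  have h1 := ENNReal.toReal_mono ENNReal.ofReal_ne_top (hm.trans h)
  rw [ENNReal.toReal_mul, ENNReal.toReal_ofReal (Real.exp_pos _).le,
    ENNReal.toReal_ofReal (Real.exp_pos _).le] at h1
  rw [Real.exp_sub, le_div_iff₀ (Real.exp_pos _), mul_comm]
  exact h1

include hu₀ hu hz in
theorem measureReal_lt_quad_le {t x : ℝ} (ht₀ : 0 ≤ t) (ht : ∀ j, t * u j ≤ 1 / 4) :
    noise.real {ξ | ∑' j, u j + x < quad u z ξ} ≤
      Real.exp (-t * x + 4 * t ^ 2 * ∑' j, u j ^ 2 + 2 * t * ∑' j, u j * z j ^ 2) := by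
  have hm := measurable_quad u z hu₀
  have h := measureReal_le_exp_of_lintegral_exp_le (c := t * (∑' j, u j + x)) (hm.const_mul t)
    (lintegral_exp_quad_le hu₀ hu hz ht₀ ht)
  refine (measureReal_mono fun ξ hξ => ?_).trans (h.trans_eq ?_)
  · exact mul_le_mul_of_nonneg_left (le_of_lt hξ) ht₀
  · congr 1
    ring

include hu₀ hu hz in
theorem measureReal_quad_le_le {t x : ℝ} (ht₀ : 0 ≤ t) (ht : ∀ j, t * u j ≤ 1 / 2) :
    noise.real {ξ | quad u z ξ ≤ ∑' j, u j + x} ≤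
      Real.exp (t * x + t ^ 2 * ∑' j, u j ^ 2 - t / 2 * ∑' j, u j * z j ^ 2) := by
  have hm := measurable_quad u z hu₀
  have h := measureReal_le_exp_of_lintegral_exp_le (c := -t * (∑' j, u j + x)) (hm.const_mul (-t))
    (lintegral_exp_neg_quad_le hu₀ hu hz ht₀ ht)
  refine (measureReal_mono fun ξ hξ => ?_).trans (h.trans_eq ?_)
  · exact mul_le_mul_of_nonpos_left hξ (neg_nonpos.2 ht₀)
  · congr 1
    ring

end bounds

/-- A Paley–Zygmund inequality. -/
theorem paley_zygmund {Ω : Type*} [MeasurableSpace Ω] {μ : Measure Ω} [IsProbabilityMeasure μ]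
    {X : Ω → ℝ} (hX : Measurable X) {b M : ℝ} (hb : 0 < b) (hM : 0 < M)
    (h1 : ENNReal.ofReal b ≤ ∫⁻ ω, ENNReal.ofReal (X ω) ∂μ)
    (h2 : ∫⁻ ω, ENNReal.ofReal (X ω ^ 2) ∂μ ≤ ENNReal.ofReal M) :
    b ^ 2 / (4 * M) ≤ μ.real {ω | b / 2 < X ω} := by
  set E : Set Ω := {ω | b / 2 < X ω} with hE
  have hEm : MeasurableSet E := measurableSet_lt measurable_const hX
  -- Off `E` the first term suffices; on `E` the other two do, by the arithmetic–geometric mean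
  -- inequality. After integration the first two contribute at most `3b/4`, so `E` must account for
  -- the remaining `b/4`.
  have hpt : ∀ ω, ENNReal.ofReal (X ω) ≤ ENNReal.ofReal (b / 2) +
      ENNReal.ofReal (b / (4 * M)) * ENNReal.ofReal (X ω ^ 2) +
      E.indicator (fun _ => ENNReal.ofReal (M / b)) ω := by
    intro ω
    by_cases hω : ω ∈ E
    · rw [Set.indicator_of_mem hω, ← ENNReal.ofReal_mul (by positivity),
        ← ENNReal.ofReal_add (by positivity) (by positivity),
        ← ENNReal.ofReal_add (by positivity) (by positivity)]
      refine ENNReal.ofReal_le_ofReal ?_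
      have h : 0 ≤ b / (4 * M) * (X ω - 2 * M / b) ^ 2 := by positivity
      have h' : b / (4 * M) * (X ω - 2 * M / b) ^ 2 =
          b / (4 * M) * X ω ^ 2 + M / b - X ω := by
        field_simp
        ring
      linarith
    · rw [Set.indicator_of_notMem hω, add_zero]
      exact le_add_right (ENNReal.ofReal_le_ofReal (not_lt.1 hω))
  have h3 := h1.trans (lintegral_mono hpt)
  rw [lintegral_add_right _ (measurable_const.indicator hEm),
    lintegral_add_right _ (by fun_prop), lintegral_const_mul _ (by fun_prop), lintegral_const,
    measure_univ, mul_one, lintegral_indicator_const hEm] at h3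
  have h4 : ENNReal.ofReal b ≤ ENNReal.ofReal (b / 2) +
      ENNReal.ofReal (b / (4 * M)) * ENNReal.ofReal M + ENNReal.ofReal (M / b) * μ E :=
    h3.trans (by gcongr)
  have hfin : ENNReal.ofReal (M / b) * μ E ≠ ⊤ :=
    ENNReal.mul_ne_top ENNReal.ofReal_ne_top (measure_ne_top _ _)
  rw [← ENNReal.ofReal_mul (by positivity), ← ENNReal.ofReal_add (by positivity) (by positivity)]
    at h4
  have h5 := ENNReal.toReal_mono (ENNReal.add_ne_top.2 ⟨ENNReal.ofReal_ne_top, hfin⟩) h4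
  rw [ENNReal.toReal_add ENNReal.ofReal_ne_top hfin, ENNReal.toReal_mul,
    ENNReal.toReal_ofReal hb.le, ENNReal.toReal_ofReal (by positivity),
    ENNReal.toReal_ofReal (by positivity)] at h5
  have h6 : b / (4 * M) * M = b / 4 := by field_simp
  rw [h6] at h5
  have h7 : b / 4 ≤ M / b * μ.real E := by
    rw [measureReal_def]
    linarith
  rw [div_mul_eq_mul_div, le_div_iff₀ hb] at h7
  rw [div_le_iff₀ (by positivity)]
  linarith

section bounds

variable {u z : ℕ+ → ℝ} (hu₀ : ∀ j, 0 ≤ u j) (hu : Summable u)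
  (hz : Summable fun j => u j * z j ^ 2)

-- Paley–Zygmund for `exp (t Q)` without signal: the first moment is at least `exp (tU + t²A)`, the
-- second at most `exp (2tU + 16t²A)`. Exceeding half of the first bound means `Q > U + tA - log 2 /
-- t`, which `hx` compares with the threshold.
include hu₀ hu in
theorem le_measureReal_lt_quad {t x : ℝ} (ht₀ : 0 < t) (ht : ∀ j, t * u j ≤ 1 / 8)
    (hx : x + Real.log 2 / t ≤ t * ∑' j, u j ^ 2) :
    Real.exp (-16 * t ^ 2 * ∑' j, u j ^ 2) / 4 ≤
      noise.real {ξ | ∑' j, u j + x < quad u 0 ξ} := by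
  have hm := measurable_quad u 0 hu₀
  set A := ∑' j, u j ^ 2 with hA
  have hA₀ : 0 ≤ A := tsum_nonneg fun j => sq_nonneg _
  set U := ∑' j, u j with hU
  have h1 := le_lintegral_exp_quad hu₀ hu ht₀.le (fun j => by linarith [ht j])
  have h2 := lintegral_exp_quad_le (z := 0) (t := 2 * t) hu₀ hu (by simp) (by positivity)
    (fun j => by linarith [ht j])
  simp only [Pi.zero_apply, ne_eq, OfNat.ofNat_ne_zero, not_false_eq_true, zero_pow, mul_zero,
    tsum_zero, add_zero] at h2
  have h3 := paley_zygmund (μ := noise) (X := fun ξ => Real.exp (t * quad u 0 ξ))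
    (by fun_prop) (Real.exp_pos _) (Real.exp_pos _) h1
    (by
      refine le_of_eq_of_le (lintegral_congr fun ξ => ?_) h2
      rw [← Real.exp_nat_mul]
      congr 2
      push_cast
      ring)
  calc _ ≤ Real.exp (2 * t ^ 2 * A - 16 * t ^ 2 * A) / 4 := by
        gcongr
        nlinarith [mul_nonneg (sq_nonneg t) hA₀]
    _ = _ := by
        rw [← Real.exp_nat_mul, mul_comm (4 : ℝ), ← div_div, ← Real.exp_sub]
        congr 2
        push_cast
        ring
    _ ≤ _ := h3
    _ ≤ _ := by
        refine measureReal_mono fun ξ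
          (hξ : Real.exp (t * U + t ^ 2 * A) / 2 < Real.exp (t * quad u 0 ξ)) => ?_
        have h4 : Real.exp (t * U + t ^ 2 * A) / 2 =
            Real.exp (t * U + t ^ 2 * A - Real.log 2) := by
          rw [Real.exp_sub, Real.exp_log two_pos]
        rw [h4, Real.exp_lt_exp] at hξ
        have h5 : t * (x + Real.log 2 / t) = t * x + Real.log 2 := by field_simp
        have h6 := mul_le_mul_of_nonneg_left hx ht₀.le
        rw [h5] at h6
        refine lt_of_mul_lt_mul_left (a := t) ?_ ht₀.le
        nlinarith

/-! ### Non-degeneracy of the error probabilities -/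

include hu₀ hu hz in
theorem ae_term_le_quad (j : ℕ+) : ∀ᵐ ξ ∂noise, u j * (z j + ξ j) ^ 2 ≤ quad u z ξ := by
  filter_upwards [ae_summable_quad hu₀ hu hz] with ξ hξ
  exact hξ.le_tsum j fun i _ => mul_nonneg (hu₀ i) (sq_nonneg _)

include hu₀ hu in
theorem measureReal_lt_quad_pos {j : ℕ+} (hj : 0 < u j) (τ : ℝ) :
    0 < noise.real {ξ | τ < quad u 0 ξ} := by
  refine ENNReal.toReal_pos (ne_of_gt ?_) (measure_ne_top _ _)
  have hopen : IsOpen {x : ℝ | τ < u j * x ^ 2} :=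
    isOpen_lt continuous_const (by fun_prop)
  have hpos : 0 < gaussianReal 0 1 {x : ℝ | τ < u j * x ^ 2} := by
    refine pos_iff_ne_zero.2 fun h => ?_
    have h0 := gaussianReal_absolutelyContinuous' 0 one_ne_zero h
    refine hopen.measure_ne_zero volume ⟨√((|τ| + 1) / u j), ?_⟩ h0
    rw [Set.mem_ofPred_eq, Real.sq_sqrt (by positivity), mul_div_cancel₀ _ hj.ne']
    linarith [le_abs_self τ]
  rw [← (measurePreserving_eval_infinitePi (fun _ : ℕ+ => gaussianReal 0 1) j).measure_preimage
    hopen.measurableSet.nullMeasurableSet] at hpos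
  refine hpos.trans_le (measure_mono_ae ?_)
  filter_upwards [ae_term_le_quad (z := 0) hu₀ hu (by simp) j] with ξ hξ hτ
  simp only [Pi.zero_apply, zero_add] at hξ
  exact lt_of_lt_of_le hτ hξ

include hu₀ hu in
theorem measureReal_lt_quad_eq_one {j : ℕ+} (hj : 0 < u j) {τ : ℝ} (hτ : τ ≤ 0) :
    noise.real {ξ | τ < quad u 0 ξ} = 1 := by
  have := nullSingletonClass_gaussianReal (μ := 0) (v := 1) one_ne_zero
  have h0 : ∀ᵐ x ∂gaussianReal 0 1, x ≠ 0 := by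
    rw [ae_iff]
    simp
  have h1 : ∀ᵐ ξ ∂noise, ξ j ≠ 0 :=
    (measurePreserving_eval_infinitePi
      (fun _ : ℕ+ => gaussianReal 0 1) j).quasiMeasurePreserving.ae h0
  have h2 : ∀ᵐ ξ ∂noise, ξ ∈ {ξ | τ < quad u 0 ξ} := by
    filter_upwards [h1, ae_term_le_quad (z := 0) hu₀ hu (by simp) j] with ξ hξ hq
    simp only [Pi.zero_apply, zero_add] at hq
    exact hτ.trans_lt (lt_of_lt_of_le (by positivity) hq)
  rw [measureReal_def, prob_compl_eq_zero_iff
    (measurableSet_lt measurable_const (measurable_quad u 0 hu₀)) |>.1 (ae_iff.1 h2)]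
  rfl

theorem neg_logMGF_neg_nonneg {a : ℝ} (ha : 0 ≤ a) (z : ℝ) : 0 ≤ -logMGF (-a) z := by
  have h1 := Real.log_nonneg (x := 1 + 2 * a) (by linarith)
  have h2 : 0 ≤ a * z ^ 2 / (1 + 2 * a) := by positivity
  rw [logMGF, mul_neg, sub_neg_eq_add, neg_mul, neg_div]
  linarith

theorem neg_logMGF_neg_le {a : ℝ} (ha : 0 ≤ a) (z : ℝ) :
    -logMGF (-a) z ≤ a + a * z ^ 2 := by
  have h1 := Real.log_le_sub_one_of_pos (x := 1 + 2 * a) (by linarith)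
  have h2 : a * z ^ 2 / (1 + 2 * a) ≤ a * z ^ 2 :=
    div_le_self (by positivity) (by linarith)
  rw [logMGF, mul_neg, sub_neg_eq_add, neg_mul, neg_div]
  linarith

include hu₀ hu hz in
theorem summable_neg_logMGF {t : ℝ} (ht : 0 ≤ t) :
    Summable fun j => -logMGF (-(t * u j)) (z j) :=
  Summable.of_nonneg_of_le (fun j => neg_logMGF_neg_nonneg (mul_nonneg ht (hu₀ j)) _)
    (fun j => neg_logMGF_neg_le (mul_nonneg ht (hu₀ j)) _)
    (((hu.add hz).mul_left t).congr fun j => by ring)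

include hu₀ hu hz in
theorem le_lintegral_exp_neg_quad {t : ℝ} (ht : 0 ≤ t) :
    ENNReal.ofReal (Real.exp (-∑' j, -logMGF (-(t * u j)) (z j))) ≤
      ∫⁻ ξ, ENNReal.ofReal (Real.exp (-t * quad u z ξ)) ∂noise := by
  obtain ⟨s, hs⟩ := (atTop : Filter (Finset ℕ+)).exists_seq_tendsto
  have hlim : Tendsto (fun n => ∫⁻ ξ, ENNReal.ofReal
      (Real.exp (-t * ∑ j ∈ s n, u j * (z j + ξ j) ^ 2)) ∂noise) atTop
      (𝓝 (∫⁻ ξ, ENNReal.ofReal (Real.exp (-t * quad u z ξ)) ∂noise)) := by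
    refine tendsto_lintegral_of_dominated_convergence (fun _ => 1) (fun n => by fun_prop)
      (fun n => ae_of_all _ fun ξ => ?_) (by simp) ?_
    · refine ENNReal.ofReal_le_one.2 (Real.exp_le_one_iff.2 ?_)
      rw [neg_mul]
      exact neg_nonpos.2 (mul_nonneg ht (Finset.sum_nonneg fun j _ =>
        mul_nonneg (hu₀ j) (sq_nonneg _)))
    · filter_upwards [ae_summable_quad hu₀ hu hz] with ξ hξ
      refine ENNReal.tendsto_ofReal ((Real.continuous_exp.tendsto _).comp ?_)
      exact (hξ.hasSum.comp hs).const_mul (-t)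
  refine ge_of_tendsto' hlim fun n => ?_
  rw [lintegral_exp_sum _ fun j => by linarith [mul_nonneg ht (hu₀ j)]]
  refine ENNReal.ofReal_le_ofReal (Real.exp_le_exp.2 (neg_le.1 ?_))
  rw [← Finset.sum_neg_distrib]
  simp only [neg_mul]
  exact (summable_neg_logMGF hu₀ hu hz ht).sum_le_tsum _
    fun j _ => neg_logMGF_neg_nonneg (mul_nonneg ht (hu₀ j)) _

theorem tendsto_neg_logMGF_div {a : ℝ} (ha : 0 ≤ a) (z : ℝ) :
    Tendsto (fun t : ℝ => -logMGF (-(t * a)) z / t) atTop (𝓝 0) := by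
  rcases ha.eq_or_lt with rfl | ha
  · simp [logMGF]
  have hlin : Tendsto (fun t : ℝ => 1 + 2 * a * t) atTop atTop :=
    tendsto_atTop_add_const_left _ _ (tendsto_id.const_mul_atTop (by positivity))
  have h1 : Tendsto (fun t : ℝ => Real.log (1 + 2 * a * t) / t) atTop (𝓝 0) := by
    have h := Real.isLittleO_log_id_atTop.comp_tendsto hlin
    have hO : (fun t : ℝ => 1 + 2 * a * t) =O[atTop] fun t : ℝ => t := by
      refine IsBigO.add ?_ (isBigO_const_mul_self _ _ _)
      exact (isLittleO_const_id_atTop (1 : ℝ)).isBigO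
    exact (h.trans_isBigO hO).tendsto_div_nhds_zero
  have h2 : Tendsto (fun t : ℝ => a * z ^ 2 / (1 + 2 * a * t)) atTop (𝓝 0) :=
    tendsto_const_nhds.div_atTop hlin
  have h3 := h2.add (h1.div_const 2)
  rw [zero_div, add_zero] at h3
  refine h3.congr' ?_
  filter_upwards [eventually_gt_atTop 0] with t ht
  have h4 : 1 - 2 * -(t * a) = 1 + 2 * a * t := by ring
  have h5 : 0 < 1 + 2 * a * t := by positivity
  rw [logMGF, h4]
  field_simp
  ring

-- If `Q > τ` almost surely, then `E exp (-tQ) ≤ exp (-tτ)`. But each factor of this Laplace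
-- transform decays only polynomially in `t` up to a bounded factor, and dominated convergence makes
-- the whole exponent `o(t)`, a contradiction for large `t`.
include hu₀ hu hz in
theorem measureReal_quad_le_pos {τ : ℝ} (hτ : 0 < τ) :
    0 < noise.real {ξ | quad u z ξ ≤ τ} := by
  refine ENNReal.toReal_pos (fun h0 => ?_) (measure_ne_top _ _)
  have hae : ∀ᵐ ξ ∂noise, τ < quad u z ξ := by
    rw [ae_iff]
    simpa only [not_lt] using h0
  have hle : ∀ t : ℝ, 0 < t → τ ≤ ∑' j, -logMGF (-(t * u j)) (z j) / t := by
    intro t ht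
    have h1 : ∫⁻ ξ, ENNReal.ofReal (Real.exp (-t * quad u z ξ)) ∂noise ≤
        ENNReal.ofReal (Real.exp (-t * τ)) := by
      calc _ ≤ ∫⁻ _, ENNReal.ofReal (Real.exp (-t * τ)) ∂noise := by
            refine lintegral_mono_ae ?_
            filter_upwards [hae] with ξ hξ
            refine ENNReal.ofReal_le_ofReal (Real.exp_le_exp.2 ?_)
            exact mul_le_mul_of_nonpos_left hξ.le (neg_nonpos.2 ht.le)
        _ = _ := by simp
    have h2 := (le_lintegral_exp_neg_quad hu₀ hu hz ht.le).trans h1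
    rw [ENNReal.ofReal_le_ofReal_iff (Real.exp_pos _).le, Real.exp_le_exp] at h2
    rw [tsum_div_const, le_div_iff₀ ht]
    linarith
  have hlim : Tendsto (fun t : ℝ => ∑' j, -logMGF (-(t * u j)) (z j) / t) atTop
      (𝓝 (∑' _ : ℕ+, (0 : ℝ))) := by
    refine tendsto_tsum_of_dominated_convergence (hu.add hz)
      (fun j => tendsto_neg_logMGF_div (hu₀ j) (z j)) ?_
    filter_upwards [eventually_gt_atTop 0] with t ht j
    have h3 := mul_nonneg ht.le (hu₀ j)
    rw [Real.norm_of_nonneg (div_nonneg (neg_logMGF_neg_nonneg h3 _) ht.le), div_le_iff₀ ht]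
    exact (neg_logMGF_neg_le h3 _).trans_eq (by ring)
  rw [tsum_zero] at hlim
  refine hτ.not_ge (ge_of_tendsto hlim ?_)
  filter_upwards [eventually_gt_atTop 0] with t ht using hle t ht

end bounds

/-! ### Moderate deviations: consistency and the size of the signal -/

section families

variable {u z : ℝ → ℕ+ → ℝ} {R : ℝ → ℝ} {C₁ C₂ : ℝ}
  (hu₀ : ∀ ε > 0, ∀ j, 0 ≤ u ε j) (hu : ∀ ε > 0, Summable (u ε))
  (hz : ∀ ε > 0, Summable fun j => u ε j * z ε j ^ 2)
  (hu₁ : ∀ ε > 0, ∀ j, u ε j ≤ u ε 1) (hpos : ∀ ε > 0, 0 < u ε 1)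
  (hC₁ : 0 < C₁) (hA₁ : ∀ ε > 0, C₁ < ∑' j, u ε j ^ 2) (hA₂ : ∀ ε > 0, ∑' j, u ε j ^ 2 < C₂)
  (hR₀ : ∀ ε > 0, 0 < R ε) (hR : Tendsto R (𝓝[>] 0) atTop)
  (huR : Tendsto (fun ε => u ε 1 * R ε) (𝓝[>] 0) (𝓝 0))

include hu₀ hu hu₁ hC₁ hA₁ hA₂ hR₀ huR in
theorem eventually_critical_value_le {x : ℝ → ℝ}
    (hα₀ : ∀ ε > 0, 0 < noise.real {ξ | ∑' j, u ε j + x ε < quad (u ε) 0 ξ})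
    (hα : Tendsto (fun ε => (R ε ^ 2)⁻¹ *
      Real.log (noise.real {ξ | ∑' j, u ε j + x ε < quad (u ε) 0 ξ})) (𝓝[>] 0) (𝓝 0))
    {δ : ℝ} (hδ : 0 < δ) : ∀ᶠ ε in 𝓝[>] 0, x ε ≤ δ * R ε := by
  have hC₂ : 0 < C₂ := hC₁.trans ((hA₁ 1 one_pos).trans (hA₂ 1 one_pos))
  -- The value `t = c R` minimizes the Chernoff exponent `-t δ R + 4 t² C₂`; the minimum is `-δ² R²
  -- / (16 C₂)`.
  set c := δ / (8 * C₂) with hc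
  have hc₀ : 0 < c := by positivity
  have h1 : ∀ᶠ ε in 𝓝[>] 0, -(δ ^ 2 / (16 * C₂)) < (R ε ^ 2)⁻¹ *
      Real.log (noise.real {ξ | ∑' j, u ε j + x ε < quad (u ε) 0 ξ}) :=
    hα.eventually (lt_mem_nhds (by rw [neg_lt_zero]; positivity))
  have h2 : ∀ᶠ ε in 𝓝[>] 0, u ε 1 * R ε < 1 / 4 / c :=
    huR.eventually (gt_mem_nhds (by positivity))
  filter_upwards [h1, h2, self_mem_nhdsWithin] with ε h1 h2 hε
  replace hε : 0 < ε := hε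
  by_contra! hx
  have hRε := hR₀ ε hε
  rw [lt_div_iff₀ hc₀] at h2
  have h3 := measureReal_lt_quad_le (z := 0) (t := c * R ε) (x := x ε) (hu₀ ε hε) (hu ε hε)
    (by simp) (by positivity) fun j => by
      nlinarith [mul_le_mul_of_nonneg_left (hu₁ ε hε j) (mul_pos hc₀ hRε).le]
  simp only [Pi.zero_apply, ne_eq, OfNat.ofNat_ne_zero, not_false_eq_true, zero_pow, mul_zero,
    tsum_zero, add_zero] at h3
  have h4 := Real.log_le_log (hα₀ ε hε) h3
  rw [Real.log_exp] at h4
  have h5 : -(c * R ε) * x ε + 4 * (c * R ε) ^ 2 * ∑' j, u ε j ^ 2 ≤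
      -(δ ^ 2 / (16 * C₂)) * R ε ^ 2 := by
    have h6 : (c * R ε) * (δ * R ε) ≤ (c * R ε) * x ε :=
      mul_le_mul_of_nonneg_left hx.le (by positivity)
    have h7 : 4 * (c * R ε) ^ 2 * ∑' j, u ε j ^ 2 ≤ 4 * (c * R ε) ^ 2 * C₂ :=
      mul_le_mul_of_nonneg_left (hA₂ ε hε).le (by positivity)
    have h8 : 4 * (c * R ε) ^ 2 * C₂ - (c * R ε) * (δ * R ε) =
        -(δ ^ 2 / (16 * C₂)) * R ε ^ 2 := by
      rw [hc]
      field_simp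
      ring
    linarith
  rw [← div_eq_inv_mul, lt_div_iff₀ (by positivity)] at h1
  linarith

include hu₀ hu hz hu₁ hpos hC₁ hA₁ hA₂ hR₀ huR in
theorem isBigO_log_typeII {c : ℝ} (hc : 0 < c)
    (hD : ∀ᶠ ε in 𝓝[>] 0, c * R ε ≤ ∑' j, u ε j * z ε j ^ 2) {x : ℝ → ℝ}
    (hα₀ : ∀ ε > 0, 0 < noise.real {ξ | ∑' j, u ε j + x ε < quad (u ε) 0 ξ} ∧
      noise.real {ξ | ∑' j, u ε j + x ε < quad (u ε) 0 ξ} < 1)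
    (hα : Tendsto (fun ε => (R ε ^ 2)⁻¹ *
      Real.log (noise.real {ξ | ∑' j, u ε j + x ε < quad (u ε) 0 ξ})) (𝓝[>] 0) (𝓝 0)) :
    (fun ε => R ε ^ 2) =O[𝓝[>] 0] fun ε =>
      Real.log (noise.real {ξ | quad (u ε) (z ε) ξ ≤ ∑' j, u ε j + x ε}) := by
  have hC₂ : 0 < C₂ := hC₁.trans ((hA₁ 1 one_pos).trans (hA₂ 1 one_pos))
  have hx := eventually_critical_value_le hu₀ hu hu₁ hC₁ hA₁ hA₂ hR₀ huR
    (fun ε hε => (hα₀ ε hε).1) hα (δ := c / 4) (by positivity)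
  -- With `x ≤ c R / 4` and signal at least `c R`, the exponent is at most `-t c R / 4 + t² C₂`,
  -- which is minimal at `t = a R`.
  set a := c / (8 * C₂) with ha
  have ha₀ : 0 < a := by positivity
  have h2 : ∀ᶠ ε in 𝓝[>] 0, u ε 1 * R ε < 1 / 2 / a :=
    huR.eventually (gt_mem_nhds (by positivity))
  refine IsBigO.of_bound (a * c / 8)⁻¹ ?_
  filter_upwards [hx, h2, hD, self_mem_nhdsWithin] with ε hx h2 hD hε
  replace hε : 0 < ε := hε
  have hRε := hR₀ ε hε
  rw [lt_div_iff₀ ha₀] at h2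
  -- A threshold at or below zero would give `α = 1`. A positive threshold makes `β > 0`, which
  -- matters because `Real.log 0 = 0`.
  have hτ : 0 < ∑' j, u ε j + x ε := by
    by_contra! h
    have := measureReal_lt_quad_eq_one (hu₀ ε hε) (hu ε hε) (hpos ε hε) h
    exact (hα₀ ε hε).2.ne this
  have hβ := measureReal_quad_le_pos (hu₀ ε hε) (hu ε hε) (hz ε hε) hτ
  have h3 := measureReal_quad_le_le (t := a * R ε) (x := x ε) (hu₀ ε hε) (hu ε hε) (hz ε hε)
    (by positivity) fun j => by
      nlinarith [mul_le_mul_of_nonneg_left (hu₁ ε hε j) (mul_pos ha₀ hRε).le]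
  have h4 := Real.log_le_log hβ h3
  rw [Real.log_exp] at h4
  have h5 : a * R ε * x ε ≤ a * R ε * (c / 4 * R ε) :=
    mul_le_mul_of_nonneg_left hx (by positivity)
  have h6 : (a * R ε) ^ 2 * ∑' j, u ε j ^ 2 ≤ (a * R ε) ^ 2 * C₂ :=
    mul_le_mul_of_nonneg_left (hA₂ ε hε).le (by positivity)
  have h7 : a * R ε / 2 * (c * R ε) ≤ a * R ε / 2 * ∑' j, u ε j * z ε j ^ 2 :=
    mul_le_mul_of_nonneg_left hD (by positivity)
  have h8 : a * R ε * (c / 4 * R ε) + (a * R ε) ^ 2 * C₂ - a * R ε / 2 * (c * R ε) =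
      -(a * c / 8) * R ε ^ 2 := by
    rw [ha]
    field_simp
    ring
  rw [Real.norm_of_nonneg (sq_nonneg _), Real.norm_eq_abs, ← div_eq_inv_mul,
    le_div_iff₀ (by positivity)]
  refine le_trans ?_ (neg_le_abs _)
  linarith

include hu₀ hu hu₁ hC₁ hA₁ hA₂ hR₀ hR huR in
theorem tendsto_log_typeI {x : ℝ → ℝ} (hx₀ : ∀ ε > 0, 0 ≤ x ε)
    (hx : Tendsto (fun ε => x ε / R ε) (𝓝[>] 0) (𝓝 0)) :
    Tendsto (fun ε => (R ε ^ 2)⁻¹ *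
      Real.log (noise.real {ξ | ∑' j, u ε j + x ε < quad (u ε) 0 ξ})) (𝓝[>] 0) (𝓝 0) := by
  have hC₂ : 0 < C₂ := hC₁.trans ((hA₁ 1 one_pos).trans (hA₂ 1 one_pos))
  have hRinv : Tendsto (fun ε => (R ε)⁻¹) (𝓝[>] 0) (𝓝 0) := hR.inv_tendsto_atTop
  -- This makes `t A ≥ x + 1 ≥ x + log 2 / t`, as the lower tail bound requires, while `t = o(R)`.
  set t : ℝ → ℝ := fun ε => (x ε + 1) / C₁ + 1 with ht
  have htR : Tendsto (fun ε => t ε * (R ε)⁻¹) (𝓝[>] 0) (𝓝 0) := by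
    have h := ((hx.add hRinv).div_const C₁).add hRinv
    simp only [add_zero, zero_div] at h
    exact h.congr fun ε => by rw [ht]; ring
  have hlow : Tendsto (fun ε => -(16 * C₂) * (t ε * (R ε)⁻¹) ^ 2 - Real.log 4 * (R ε)⁻¹ ^ 2)
      (𝓝[>] 0) (𝓝 0) := by
    have h := ((htR.pow 2).const_mul (-(16 * C₂))).sub ((hRinv.pow 2).const_mul (Real.log 4))
    simpa using h
  have htu : Tendsto (fun ε => (t ε * (R ε)⁻¹) * (u ε 1 * R ε)) (𝓝[>] 0) (𝓝 0) := by
    simpa using htR.mul huR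
  have htu' : ∀ᶠ ε in 𝓝[>] 0, (t ε * (R ε)⁻¹) * (u ε 1 * R ε) < 1 / 8 :=
    htu.eventually (gt_mem_nhds (by norm_num))
  refine tendsto_of_tendsto_of_tendsto_of_le_of_le' hlow tendsto_const_nhds ?_ ?_
  · filter_upwards [htu', self_mem_nhdsWithin] with ε h1 hε
    replace hε : 0 < ε := hε
    have hRε := hR₀ ε hε
    have hx₀ε := hx₀ ε hε
    have ht₁ : 1 ≤ t ε := le_add_of_nonneg_left (by positivity)
    have ht₀ : 0 < t ε := by linarith
    have h2 : (t ε * (R ε)⁻¹) * (u ε 1 * R ε) = t ε * u ε 1 := by field_simp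
    rw [h2] at h1
    have h3 := le_measureReal_lt_quad (t := t ε) (x := x ε) (hu₀ ε hε) (hu ε hε) ht₀
      (fun j => (mul_le_mul_of_nonneg_left (hu₁ ε hε j) ht₀.le).trans h1.le) (by
        have h4 : Real.log 2 / t ε ≤ 1 := by
          rw [div_le_one ht₀]
          linarith [Real.log_two_lt_d9]
        have h5 : t ε * C₁ = x ε + 1 + C₁ := by rw [ht]; field_simp
        have h6 := mul_le_mul_of_nonneg_left (hA₁ ε hε).le ht₀.le
        linarith)
    have h7 := Real.log_le_log (by positivity) h3
    rw [Real.log_div (Real.exp_ne_zero _) (by norm_num), Real.log_exp] at h7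
    have h8 : t ε ^ 2 * ∑' j, u ε j ^ 2 ≤ t ε ^ 2 * C₂ :=
      mul_le_mul_of_nonneg_left (hA₂ ε hε).le (sq_nonneg _)
    rw [← div_eq_inv_mul, le_div_iff₀ (by positivity)]
    have h9 : (-(16 * C₂) * (t ε * (R ε)⁻¹) ^ 2 - Real.log 4 * (R ε)⁻¹ ^ 2) * R ε ^ 2 =
        -16 * (t ε ^ 2 * C₂) - Real.log 4 := by
      field_simp
    linarith
  · filter_upwards with ε
    exact mul_nonpos_of_nonneg_of_nonpos (by positivity)
      (Real.log_nonpos measureReal_nonneg measureReal_le_one)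

include hu₀ hu hz hu₁ hpos hC₁ hA₁ hA₂ hR₀ hR huR in
/-- Consistency in the zone of moderate deviations is the same as a signal of the order of the
deviation. -/
theorem consistent_iff_signal :
    (∀ x : ℝ → ℝ,
      (∀ ε > 0, 0 < noise.real {ξ | ∑' j, u ε j + x ε < quad (u ε) 0 ξ} ∧
        noise.real {ξ | ∑' j, u ε j + x ε < quad (u ε) 0 ξ} < 1) →
      Tendsto (fun ε => (R ε ^ 2)⁻¹ *
        Real.log (noise.real {ξ | ∑' j, u ε j + x ε < quad (u ε) 0 ξ})) (𝓝[>] 0) (𝓝 0) →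
      (fun ε => R ε ^ 2) =O[𝓝[>] 0] fun ε =>
        Real.log (noise.real {ξ | quad (u ε) (z ε) ξ ≤ ∑' j, u ε j + x ε})) ↔
    ∃ c > 0, ∀ᶠ ε in 𝓝[>] 0, c * R ε ≤ ∑' j, u ε j * z ε j ^ 2 := by
  refine ⟨fun H => ?_, fun ⟨c, hc, hD⟩ x hα₀ hα =>
    isBigO_log_typeII hu₀ hu hz hu₁ hpos hC₁ hA₁ hA₂ hR₀ huR hc hD hα₀ hα⟩
  by_contra! hno
  have hC₂ : 0 < C₂ := hC₁.trans ((hA₁ 1 one_pos).trans (hA₂ 1 one_pos))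
  set D : ℝ → ℝ := fun ε => ∑' j, u ε j * z ε j ^ 2 with hDdef
  have hD₀ : ∀ ε > 0, 0 ≤ D ε := fun ε hε =>
    tsum_nonneg fun j => mul_nonneg (hu₀ ε hε j) (sq_nonneg _)
  have hex : ∀ n : ℕ, ∃ ε : ℝ, 0 < ε ∧ ε < 1 / ((n : ℝ) + 1) ∧
      D ε < 1 / ((n : ℝ) + 1) * R ε := by
    intro n
    have hev : ∀ᶠ ε : ℝ in 𝓝[>] 0, 0 < ε ∧ ε < 1 / ((n : ℝ) + 1) :=
      Ioo_mem_nhdsGT (by positivity)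
    obtain ⟨ε, h1, h2⟩ := ((hno _ (Nat.one_div_pos_of_nat (n := n))).and_eventually hev).exists
    exact ⟨ε, h2.1, h2.2, h1⟩
  choose e he₀ he₁ heD using hex
  have he : Tendsto e atTop (𝓝[>] 0) := by
    refine tendsto_nhdsWithin_iff.2 ⟨?_, Eventually.of_forall he₀⟩
    exact squeeze_zero (fun n => (he₀ n).le) (fun n => (he₁ n).le)
      tendsto_one_div_add_atTop_nhds_zero_nat
  classical
  -- The terms `4 C₂` and `2 D` absorb the variance and signal terms of Chernoff's bound at `t = 1`,
  -- and the extra `1` leaves the exponent `-1`. The signal is added only along the bad sequence,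
  -- where it is `o(R)`, so that `x = o(R)` everywhere.
  set x : ℝ → ℝ := fun ε => 4 * C₂ + 1 + if ε ∈ Set.range e then 2 * D ε else 0 with hx
  have hx₀ : ∀ ε > 0, 0 < x ε := by
    intro ε hε
    have := hD₀ ε hε
    simp only [hx]
    split_ifs <;> positivity
  have hif : Tendsto (fun ε => (if ε ∈ Set.range e then 2 * D ε else 0) / R ε) (𝓝[>] 0)
      (𝓝 0) := by
    rw [Metric.tendsto_nhds]
    intro δ hδ
    obtain ⟨N, hN⟩ := exists_nat_one_div_lt (half_pos hδ)
    -- Below the first `N` members of the sequence, only members with index at least `N` can occur.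
    have hne : ∀ᶠ ε in 𝓝[>] (0 : ℝ), ∀ n ∈ Finset.range N, ε < e n :=
      (Finset.range N).eventually_all.2 fun n _ =>
        eventually_nhdsWithin_of_eventually_nhds (eventually_lt_nhds (he₀ n))
    filter_upwards [hne, self_mem_nhdsWithin] with ε hne hε
    replace hε : 0 < ε := hε
    have hRε := hR₀ ε hε
    split_ifs with hmem
    · obtain ⟨n, rfl⟩ := hmem
      have hn : N ≤ n := by
        by_contra! h
        exact lt_irrefl _ (hne n (Finset.mem_range.2 h))
      have h1 : 1 / ((n : ℝ) + 1) ≤ 1 / ((N : ℝ) + 1) := by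
        have : (N : ℝ) ≤ n := by exact_mod_cast hn
        gcongr
      have := hD₀ _ hε
      rw [Real.dist_eq, sub_zero, abs_of_nonneg (by positivity), div_lt_iff₀ hRε]
      have h2 := mul_le_mul_of_nonneg_right (h1.trans hN.le) hRε.le
      linarith [heD n]
    · simpa using hδ
  have hxR : Tendsto (fun ε => x ε / R ε) (𝓝[>] 0) (𝓝 0) := by
    have h := (tendsto_const_nhds (x := 4 * C₂ + 1)).div_atTop hR |>.add hif
    rw [add_zero] at h
    exact h.congr fun ε => by rw [hx]; ring
  have hτ : ∀ ε > 0, 0 < ∑' j, u ε j + x ε := fun ε hε =>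
    add_pos_of_nonneg_of_pos (tsum_nonneg (hu₀ ε hε)) (hx₀ ε hε)
  have hcompl : ∀ ε > 0, ∀ y : ℕ+ → ℝ, noise.real {ξ | quad (u ε) y ξ ≤ ∑' j, u ε j + x ε} =
      1 - noise.real {ξ | ∑' j, u ε j + x ε < quad (u ε) y ξ} := by
    intro ε hε y
    rw [← probReal_compl_eq_one_sub
      (measurableSet_lt measurable_const (measurable_quad _ y (hu₀ ε hε)))]
    congr 1
    ext ξ
    simp
  have hO := H x (fun ε hε => ⟨measureReal_lt_quad_pos (hu₀ ε hε) (hu ε hε) (hpos ε hε) _, by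
      have h := measureReal_quad_le_pos (z := 0) (hu₀ ε hε) (hu ε hε) (by simp) (hτ ε hε)
      rw [hcompl ε hε] at h
      linarith⟩)
    (tendsto_log_typeI hu₀ hu hu₁ hC₁ hA₁ hA₂ hR₀ hR huR (fun ε hε => (hx₀ ε hε).le) hxR)
  obtain ⟨C, hC₀, hC⟩ := hO.exists_pos
  have huto : Tendsto (fun ε => u ε 1) (𝓝[>] 0) (𝓝 0) := by
    have h := huR.mul hR.inv_tendsto_atTop
    rw [zero_mul] at h
    refine h.congr' ?_
    filter_upwards [self_mem_nhdsWithin] with ε hε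
    have := hR₀ ε hε
    simp only [Pi.inv_apply]
    field_simp
  have hu4 : ∀ᶠ ε in 𝓝[>] 0, u ε 1 < 1 / 4 := huto.eventually (gt_mem_nhds (by norm_num))
  have hRbig : ∀ᶠ ε in 𝓝[>] 0, C * Real.log 2 + 1 < R ε ∧ 1 < R ε :=
    (hR.eventually_gt_atTop _).and (hR.eventually_gt_atTop _)
  obtain ⟨n, h1, h2, h3, h4⟩ := (he.eventually (hC.bound.and (hu4.and hRbig))).exists
  have hε := he₀ n
  have h5 := measureReal_lt_quad_le (t := 1) (x := x (e n)) (hu₀ _ hε) (hu _ hε) (hz _ hε)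
    zero_le_one fun j => by linarith [hu₁ _ hε j]
  have h6 : -1 * x (e n) + 4 * 1 ^ 2 * ∑' j, u (e n) j ^ 2 +
      2 * 1 * ∑' j, u (e n) j * z (e n) j ^ 2 ≤ -1 := by
    have h7 : x (e n) = 4 * C₂ + 1 + 2 * D (e n) := by
      simp only [hx, Set.mem_range_self, if_true]
    rw [h7]
    linarith [hA₂ _ hε]
  have h8 : Real.exp (-1) ≤ 1 / 2 := by
    rw [Real.exp_neg, inv_eq_one_div]
    exact one_div_le_one_div_of_le two_pos (by linarith [Real.exp_one_gt_d9])
  -- Since `exp (-1) ≤ 1/2`, we get `β ≥ 1/2`; the assumed bound then forces `R² ≤ C log 2`, against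
  -- `R → ∞`.
  have h9 := (h5.trans (Real.exp_le_exp.2 h6)).trans h8
  have h10 : 1 / 2 ≤ noise.real {ξ | quad (u (e n)) (z (e n)) ξ ≤ ∑' j, u (e n) j + x (e n)} := by
    rw [hcompl _ hε]
    linarith
  have h11 := Real.log_le_log (by norm_num) h10
  rw [one_div, Real.log_inv] at h11
  rw [Real.norm_of_nonneg (sq_nonneg _), Real.norm_eq_abs,
    abs_of_nonpos (Real.log_nonpos measureReal_nonneg measureReal_le_one)] at h1
  nlinarith [mul_le_mul_of_nonneg_left (neg_le.1 h11) hC₀.le]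

end families

/-! ### From the tests to the quadratic form -/

/-- The normalized weights `ε⁻² ϰ_{εj}²`. -/
noncomputable def normWeight (w : ℝ → ℕ → ℝ) (ε : ℝ) (j : ℕ+) : ℝ := w ε j ^ 2 / ε ^ 2

section weights

variable {w : ℝ → ℕ → ℝ} {ε : ℝ}

theorem normWeight_nonneg (w : ℝ → ℕ → ℝ) (ε : ℝ) (j : ℕ+) : 0 ≤ normWeight w ε j := by
  unfold normWeight
  positivity

theorem tsum_normWeight (w : ℝ → ℕ → ℝ) (ε : ℝ) :
    ∑' j, normWeight w ε j = rhoSq w ε / ε ^ 2 := by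
  simp only [normWeight, tsum_div_const, rhoSq]

theorem tsum_normWeight_sq (w : ℝ → ℕ → ℝ) (ε : ℝ) :
    ∑' j, normWeight w ε j ^ 2 = bigA w ε := by
  rw [bigA, ← tsum_mul_left]
  refine tsum_congr fun j => ?_
  rw [normWeight, div_pow, div_eq_inv_mul, ← pow_mul, ← pow_mul]

theorem stat_obs (φ : ℕ+ → L2Unit) (hε : 0 < ε) (S : L2Unit) (ξ : ℕ+ → ℝ) :
    stat w ε (obs φ ε S ξ) =
      ε ^ 2 * (quad (normWeight w ε) (fun j => coeff φ S j / ε) ξ - ∑' j, normWeight w ε j) := by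
  have h : ∀ j : ℕ+, w ε j ^ 2 * obs φ ε S ξ j ^ 2 =
      ε ^ 4 * (normWeight w ε j * (coeff φ S j / ε + ξ j) ^ 2) := by
    intro j
    rw [normWeight, obs]
    field_simp
  rw [stat, tsum_congr h, tsum_mul_left, tsum_normWeight, quad]
  field_simp

theorem lt_stat_iff (φ : ℕ+ → L2Unit) (hε : 0 < ε) (hA : 0 < bigA w ε) (S : L2Unit) (x : ℝ)
    (ξ : ℕ+ → ℝ) :
    obs φ ε S ξ ∈ rejection w ε x ↔
      ∑' j, normWeight w ε j + x * √(bigA w ε) / ε ^ 2 <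
        quad (normWeight w ε) (fun j => coeff φ S j / ε) ξ := by
  have hs : 0 < √(bigA w ε) := Real.sqrt_pos.2 hA
  change x < (√(bigA w ε))⁻¹ * stat w ε (obs φ ε S ξ) ↔ _
  rw [stat_obs φ hε, ← div_eq_inv_mul, lt_div_iff₀ hs, ← lt_sub_iff_add_lt',
    div_lt_iff₀ (by positivity), mul_comm (ε ^ 2)]

theorem typeI_eq (φ : ℕ+ → L2Unit) (hε : 0 < ε) (hA : 0 < bigA w ε) (x : ℝ) :
    typeI φ w ε x = noise.real {ξ | ∑' j, normWeight w ε j + x * √(bigA w ε) / ε ^ 2 <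
      quad (normWeight w ε) 0 ξ} := by
  have h0 : (fun j => coeff φ 0 j / ε) = 0 := by
    funext j
    simp [coeff]
  simp only [typeI, lt_stat_iff φ hε hA, h0]

theorem typeII_eq (φ : ℕ+ → L2Unit) (hε : 0 < ε) (hA : 0 < bigA w ε) (x : ℝ) (S : L2Unit) :
    typeII φ w ε x S = noise.real {ξ | quad (normWeight w ε) (fun j => coeff φ S j / ε) ξ ≤
      ∑' j, normWeight w ε j + x * √(bigA w ε) / ε ^ 2} := by
  simp only [typeII, lt_stat_iff φ hε hA, not_lt]

theorem summable_coeff_sq {φ : ℕ+ → L2Unit} (hφ : Orthonormal ℝ φ) (S : L2Unit) :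
    Summable fun j => coeff φ S j ^ 2 := by
  simpa [coeff] using hφ.inner_products_summable (x := S)

theorem tsum_coeff_sq_le {φ : ℕ+ → L2Unit} (hφ : Orthonormal ℝ φ) (S : L2Unit) :
    ∑' j, coeff φ S j ^ 2 ≤ ‖S‖ ^ 2 := by
  simpa [coeff] using hφ.tsum_inner_products_le (x := S)

namespace Conditions

variable (hw : Conditions w)

include hw

theorem bigA_pos (hε : 0 < ε) : 0 < bigA w ε := by
  obtain ⟨C₁, h₁, C₂, -, h⟩ := hw.A2
  exact h₁.trans (h ε hε).1

theorem sq_le_first (hε : 0 < ε) (j : ℕ+) : w ε j ^ 2 ≤ w ε 1 ^ 2 :=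
  hw.A1 ε hε (Set.mem_Ici.2 le_rfl) (Set.mem_Ici.2 j.2) j.2

theorem first_sq_pos (hε : 0 < ε) : 0 < w ε 1 ^ 2 := by
  refine (sq_nonneg _).lt_of_ne fun h => (hw.bigA_pos hε).ne' ?_
  rw [← tsum_normWeight_sq]
  have h0 : ∀ j : ℕ+, normWeight w ε j ^ 2 = 0 := fun j => by
    have h1 : w ε j ^ 2 = 0 := le_antisymm (h ▸ hw.sq_le_first hε j) (sq_nonneg _)
    rw [normWeight, h1]
    simp
  simp [h0]

theorem summable_normWeight (hε : 0 < ε) : Summable (normWeight w ε) :=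
  (hw.summable ε hε).div_const _

theorem summable_sq_mul_sq (hε : 0 < ε) {θ : ℕ+ → ℝ} (hθ : Summable fun j => θ j ^ 2) :
    Summable fun j : ℕ+ => w ε j ^ 2 * θ j ^ 2 :=
  Summable.of_nonneg_of_le (fun _ => by positivity)
    (fun j => mul_le_mul_of_nonneg_right (hw.sq_le_first hε j) (sq_nonneg _)) (hθ.mul_left _)

theorem summable_normWeight_mul (hε : 0 < ε) {θ : ℕ+ → ℝ} (hθ : Summable fun j => θ j ^ 2) :
    Summable fun j : ℕ+ => normWeight w ε j * (θ j / ε) ^ 2 := by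
  refine ((hw.summable_sq_mul_sq hε hθ).div_const (ε ^ 4)).congr fun j => ?_
  rw [normWeight]
  field_simp

end Conditions

theorem tsum_normWeight_mul (w : ℝ → ℕ → ℝ) (hε : 0 < ε) (θ : ℕ+ → ℝ) :
    ∑' j : ℕ+, normWeight w ε j * (θ j / ε) ^ 2 = (∑' j : ℕ+, w ε j ^ 2 * θ j ^ 2) / ε ^ 4 := by
  rw [← tsum_div_const]
  refine tsum_congr fun j => ?_
  rw [normWeight]
  field_simp

end weights

/-- Consistency of the tests generated by `T_ε` in the zone of moderate deviations. -/
theorem ldConsistent_iff_signal {φ : ℕ+ → L2Unit} (hφ : Orthonormal ℝ φ) {w : ℝ → ℕ → ℝ}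
    (hw : Conditions w) {R : ℝ → ℝ} (hR₀ : ∀ ε > 0, 0 < R ε) (hR : Tendsto R (𝓝[>] 0) atTop)
    (huR : Tendsto (fun ε => w ε 1 ^ 2 / ε ^ 2 * R ε) (𝓝[>] 0) (𝓝 0)) (S : ℝ → L2Unit) :
    LDConsistent φ w R S ↔ ∃ c > 0, ∀ᶠ ε in 𝓝[>] 0,
      c * R ε ≤ (∑' j : ℕ+, w ε j ^ 2 * coeff φ (S ε) j ^ 2) / ε ^ 4 := by
  obtain ⟨C₁, hC₁, C₂, -, hA⟩ := hw.A2
  have key := consistent_iff_signal (u := normWeight w)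
    (z := fun ε j => coeff φ (S ε) j / ε) (R := R) (C₁ := C₁) (C₂ := C₂)
    (fun ε _ => normWeight_nonneg w ε) (fun ε hε => hw.summable_normWeight hε)
    (fun ε hε => hw.summable_normWeight_mul hε (summable_coeff_sq hφ _))
    (fun ε hε j => div_le_div_of_nonneg_right (hw.sq_le_first hε j) (sq_nonneg _))
    (fun ε hε => div_pos (hw.first_sq_pos hε) (by positivity)) hC₁
    (fun ε hε => (hA ε hε).1.trans_eq (tsum_normWeight_sq w ε).symm)
    (fun ε hε => (tsum_normWeight_sq w ε).trans_lt (hA ε hε).2) hR₀ hR huR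
  have hD : (∃ c > 0, ∀ᶠ ε in 𝓝[>] 0,
      c * R ε ≤ ∑' j, normWeight w ε j * (coeff φ (S ε) j / ε) ^ 2) ↔
      ∃ c > 0, ∀ᶠ ε in 𝓝[>] 0,
        c * R ε ≤ (∑' j : ℕ+, w ε j ^ 2 * coeff φ (S ε) j ^ 2) / ε ^ 4 := by
    refine exists_congr fun c => and_congr_right fun _ => eventually_congr ?_
    filter_upwards [self_mem_nhdsWithin] with ε hε
    rw [tsum_normWeight_mul w hε]
  rw [← hD, ← key]
  have hI : ∀ x : ℝ → ℝ, (fun ε => (R ε ^ 2)⁻¹ * Real.log (typeI φ w ε (x ε))) =ᶠ[𝓝[>] 0]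
      fun ε => (R ε ^ 2)⁻¹ * Real.log (noise.real {ξ | ∑' j, normWeight w ε j +
        x ε * √(bigA w ε) / ε ^ 2 < quad (normWeight w ε) 0 ξ}) := fun x => by
    filter_upwards [self_mem_nhdsWithin] with ε hε
    rw [typeI_eq φ hε (hw.bigA_pos hε)]
  have hII : ∀ x : ℝ → ℝ, (fun ε => Real.log (typeII φ w ε (x ε) (S ε))) =ᶠ[𝓝[>] 0]
      fun ε => Real.log (noise.real {ξ | quad (normWeight w ε) (fun j => coeff φ (S ε) j / ε) ξ ≤
        ∑' j, normWeight w ε j + x ε * √(bigA w ε) / ε ^ 2}) := fun x => by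
    filter_upwards [self_mem_nhdsWithin] with ε hε
    rw [typeII_eq φ hε (hw.bigA_pos hε)]
  have hα : ∀ x : ℝ → ℝ, (∀ ε > 0, 0 < typeI φ w ε (x ε) ∧ typeI φ w ε (x ε) < 1) ↔
      ∀ ε > 0, 0 < noise.real {ξ | ∑' j, normWeight w ε j +
        x ε * √(bigA w ε) / ε ^ 2 < quad (normWeight w ε) 0 ξ} ∧ noise.real {ξ |
        ∑' j, normWeight w ε j + x ε * √(bigA w ε) / ε ^ 2 < quad (normWeight w ε) 0 ξ} < 1 :=
    fun x => forall₂_congr fun ε hε => by rw [typeI_eq φ hε (hw.bigA_pos hε)]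
  constructor
  · intro H x h1 h2
    -- Critical values are arbitrary, so the factor `√A_ε / ε²` between the two normalizations can
    -- be absorbed into them.
    have hx : ∀ ε > 0, x ε = x ε * ε ^ 2 / √(bigA w ε) * √(bigA w ε) / ε ^ 2 := fun ε hε => by
      have := Real.sqrt_pos.2 (hw.bigA_pos hε)
      field_simp
    have h := H fun ε => x ε * ε ^ 2 / √(bigA w ε)
    rw [hα, tendsto_congr' (hI _), isBigO_congr EventuallyEq.rfl (hII _)] at h
    have h3 := h (fun ε hε => by rw [← hx ε hε]; exact h1 ε hε) (h2.congr' (by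
      filter_upwards [self_mem_nhdsWithin] with ε hε
      rw [← hx ε hε]))
    refine h3.congr' EventuallyEq.rfl ?_
    filter_upwards [self_mem_nhdsWithin] with ε hε
    rw [← hx ε hε]
  · intro H x
    rw [hα, tendsto_congr' (hI _), isBigO_congr EventuallyEq.rfl (hII _)]
    exact H fun ε => x ε * √(bigA w ε) / ε ^ 2

/-! ### Orders of the weights -/

theorem tsum_pow_four {w : ℝ → ℕ → ℝ} {ε : ℝ} (hε : 0 < ε) :
    ∑' j : ℕ+, w ε j ^ 4 = bigA w ε * ε ^ 4 := by
  rw [bigA]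
  field_simp

namespace Conditions

variable {w : ℝ → ℕ → ℝ} {ε : ℝ} (hw : Conditions w)

include hw

theorem rhoSq_pos (hε : 0 < ε) : 0 < rhoSq w ε :=
  (hw.summable ε hε).tsum_pos (fun _ => sq_nonneg _) 1 (hw.first_sq_pos hε)

/-- Partial sums eventually exceed half of the positive total. Without boundedness the supremum in
`ℕ` would be the default `0`. -/
theorem bddAbove_kIdx (hε : 0 < ε) :
    BddAbove {k : ℕ | ∑ j ∈ Finset.Ico 1 k, w ε j ^ 2 ≤ rhoSq w ε / 2} := by
  have hs : Summable fun n : ℕ => w ε (n + 1) ^ 2 := by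
    simpa using (summable_pnat_iff_summable_succ (f := fun n : ℕ => w ε n ^ 2)).1
      (hw.summable ε hε)
  have hsum : HasSum (fun n : ℕ => w ε (n + 1) ^ 2) (rhoSq w ε) := by
    rw [rhoSq, tsum_pnat_eq_tsum_succ (f := fun n : ℕ => w ε n ^ 2)]
    exact hs.hasSum
  obtain ⟨N, hN⟩ := (hsum.tendsto_sum_nat.eventually
    (lt_mem_nhds (half_lt_self (hw.rhoSq_pos hε)))).exists
  refine ⟨N + 1, fun k (hk : ∑ j ∈ Finset.Ico 1 k, w ε j ^ 2 ≤ rhoSq w ε / 2) => ?_⟩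
  by_contra! h
  have h1 : ∑ j ∈ Finset.Ico 1 (N + 1), w ε j ^ 2 ≤ ∑ j ∈ Finset.Ico 1 k, w ε j ^ 2 :=
    Finset.sum_le_sum_of_subset_of_nonneg (Finset.Ico_subset_Ico_right h.le)
      fun _ _ _ => sq_nonneg _
  have h2 : ∑ j ∈ Finset.Ico 1 (N + 1), w ε j ^ 2 = ∑ n ∈ Finset.range N, w ε (n + 1) ^ 2 := by
    rw [Finset.sum_Ico_eq_sum_range]
    simp [add_comm]
  linarith

theorem one_le_kIdx (hε : 0 < ε) : 1 ≤ kIdx w ε := by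
  refine le_csSup (hw.bddAbove_kIdx hε) ?_
  change ∑ j ∈ Finset.Ico 1 1, w ε j ^ 2 ≤ rhoSq w ε / 2
  simpa using (half_pos (hw.rhoSq_pos hε)).le

theorem sq_antitone (hε : 0 < ε) {i j : ℕ} (hi : 1 ≤ i) (hij : i ≤ j) :
    w ε j ^ 2 ≤ w ε i ^ 2 :=
  hw.A1 ε hε (Set.mem_Ici.2 hi) (Set.mem_Ici.2 (hi.trans hij)) hij

/-- By maximality of `k_ε`, the first `k_ε` weights already sum to more than `ρ_ε² / 2`. -/
theorem rhoSq_le (hε : 0 < ε) : rhoSq w ε ≤ 2 * kIdx w ε * w ε 1 ^ 2 := by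
  have h1 : rhoSq w ε / 2 < ∑ j ∈ Finset.Ico 1 (kIdx w ε + 1), w ε j ^ 2 := by
    by_contra! h
    have : kIdx w ε + 1 ≤ kIdx w ε := le_csSup (hw.bddAbove_kIdx hε) h
    omega
  have h2 : ∑ j ∈ Finset.Ico 1 (kIdx w ε + 1), w ε j ^ 2 ≤
      ∑ j ∈ Finset.Ico 1 (kIdx w ε + 1), w ε 1 ^ 2 :=
    Finset.sum_le_sum fun j hj => hw.sq_antitone hε le_rfl (Finset.mem_Ico.1 hj).1
  rw [Finset.sum_const, Nat.card_Ico, nsmul_eq_mul, Nat.add_sub_cancel] at h2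
  linarith

theorem summable_pow_four (hε : 0 < ε) : Summable fun j : ℕ+ => w ε j ^ 4 := by
  refine (hw.summable_sq_mul_sq hε (θ := fun j => w ε j) (hw.summable ε hε)).congr fun j => ?_
  ring

theorem bigA_mul_le (hε : 0 < ε) : bigA w ε * ε ^ 4 ≤ 2 * kIdx w ε * (w ε 1 ^ 2) ^ 2 := by
  rw [← tsum_pow_four hε]
  calc ∑' j : ℕ+, w ε j ^ 4 ≤ ∑' j : ℕ+, w ε 1 ^ 2 * w ε j ^ 2 := by
        refine (hw.summable_pow_four hε).tsum_le_tsum (fun j => ?_)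
          ((hw.summable ε hε).mul_left _)
        nlinarith [mul_le_mul_of_nonneg_right (hw.sq_le_first hε j) (sq_nonneg (w ε j))]
    _ = w ε 1 ^ 2 * rhoSq w ε := by rw [tsum_mul_left, rhoSq]
    _ ≤ w ε 1 ^ 2 * (2 * kIdx w ε * w ε 1 ^ 2) := by
        gcongr
        exact hw.rhoSq_le hε
    _ = _ := by ring

theorem le_bigA_mul (hε : 0 < ε) : kIdx w ε * kappaSq w ε ^ 2 ≤ bigA w ε * ε ^ 4 := by
  have hs : Summable fun n : ℕ => w ε (n + 1) ^ 4 := by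
    simpa using (summable_pnat_iff_summable_succ (f := fun n : ℕ => w ε n ^ 4)).1
      (hw.summable_pow_four hε)
  rw [← tsum_pow_four hε, tsum_pnat_eq_tsum_succ (f := fun n : ℕ => w ε n ^ 4)]
  refine le_trans ?_ (hs.sum_le_tsum (Finset.range (kIdx w ε)) fun n _ => by positivity)
  calc (kIdx w ε : ℝ) * kappaSq w ε ^ 2
      = ∑ _n ∈ Finset.range (kIdx w ε), kappaSq w ε ^ 2 := by simp
    _ ≤ _ := by
        refine Finset.sum_le_sum fun n hn => ?_
        have h := hw.sq_antitone hε (Nat.le_add_left 1 n)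
          (Nat.succ_le_of_lt (Finset.mem_range.1 hn))
        calc kappaSq w ε ^ 2 ≤ (w ε (n + 1) ^ 2) ^ 2 :=
              pow_le_pow_left₀ (sq_nonneg _) h 2
          _ = _ := by ring

theorem kappaSq_le_first (hε : 0 < ε) : kappaSq w ε ≤ w ε 1 ^ 2 :=
  hw.sq_antitone hε le_rfl (hw.one_le_kIdx hε)

/-- Two-sided bounds on the weights in terms of the order of `k_ε`. -/
theorem exists_weight_bounds {κ E : ℝ → ℝ} (hκ : ∀ ε > 0, 0 < κ ε) (hE : ∀ ε > 0, 0 < E ε)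
    (hEκ : ∀ ε > 0, E ε ^ 2 * κ ε = ε ^ 4)
    (hk : (fun ε => (kIdx w ε : ℝ)) =Θ[𝓝[>] 0] κ) :
    ∃ a > 0, ∃ b > 0, ∀ᶠ ε in 𝓝[>] 0, a * E ε ≤ kappaSq w ε ∧ w ε 1 ^ 2 ≤ b * E ε := by
  obtain ⟨C₁, hC₁, C₂, hC₂, hA⟩ := hw.A2
  obtain ⟨q, hq, hkq⟩ := hk.1.exists_pos
  obtain ⟨p, hp, hkp⟩ := hk.2.exists_pos
  obtain ⟨C, hC, hwC⟩ := hw.A4_first.1.exists_pos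
  -- The constants come from `k_ε ϰ_ε⁴ ≤ A_ε ε⁴ ≤ 2 k_ε ϰ_{ε1}⁴`, with `A_ε` between `C₁` and `C₂`,
  -- `k_ε ≤ q κ`, `κ ≤ p k_ε`, `ϰ_{ε1}² ≤ C ϰ_ε²` and `ε⁴ = E² κ`.
  refine ⟨√(C₁ / (2 * q * C ^ 2)), by positivity, C * √(p * C₂), by positivity, ?_⟩
  filter_upwards [hkq.bound, hkp.bound, hwC.bound, self_mem_nhdsWithin] with ε h1 h2 h3 hε
  replace hε : 0 < ε := hε
  have hκε := hκ ε hε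
  have hEε := hE ε hε
  have hks : 0 ≤ kappaSq w ε := sq_nonneg _
  rw [Real.norm_of_nonneg (Nat.cast_nonneg _), Real.norm_of_nonneg hκε.le] at h1 h2
  rw [Real.norm_of_nonneg (sq_nonneg _), Real.norm_of_nonneg hks] at h3
  constructor
  · rw [← pow_le_pow_iff_left₀ (by positivity) hks two_ne_zero, mul_pow,
      Real.sq_sqrt (by positivity), div_mul_eq_mul_div, div_le_iff₀ (by positivity)]
    refine le_of_mul_le_mul_right ?_ hκε
    calc C₁ * E ε ^ 2 * κ ε = C₁ * ε ^ 4 := by rw [mul_assoc, hEκ ε hε]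
      _ ≤ bigA w ε * ε ^ 4 := by gcongr; exact (hA ε hε).1.le
      _ ≤ 2 * kIdx w ε * (w ε 1 ^ 2) ^ 2 := hw.bigA_mul_le hε
      _ ≤ 2 * (q * κ ε) * (C * kappaSq w ε) ^ 2 := by gcongr
      _ = _ := by ring
  · rw [mul_assoc]
    refine h3.trans (mul_le_mul_of_nonneg_left ?_ hC.le)
    rw [← pow_le_pow_iff_left₀ hks (by positivity) two_ne_zero, mul_pow,
      Real.sq_sqrt (by positivity)]
    refine le_of_mul_le_mul_right ?_ hκε
    calc kappaSq w ε ^ 2 * κ ε ≤ kappaSq w ε ^ 2 * (p * kIdx w ε) := by gcongr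
      _ = p * (kIdx w ε * kappaSq w ε ^ 2) := by ring
      _ ≤ p * (bigA w ε * ε ^ 4) :=
        mul_le_mul_of_nonneg_left (hw.le_bigA_mul hε) hp.le
      _ ≤ p * (C₂ * ε ^ 4) := by gcongr; exact (hA ε hε).2.le
      _ = _ := by rw [← hEκ ε hε]; ring

end Conditions

/-! ### Projections and the Besov ball -/

section projection

variable {φ : ℕ+ → L2Unit}

/-- The projection of `S` on the span of the `φ_j` with `j ∈ F`. -/
noncomputable def proj (φ : ℕ+ → L2Unit) (F : Finset ℕ+) (S : L2Unit) : L2Unit :=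
  ∑ j ∈ F, coeff φ S j • φ j

theorem inner_proj_left (F : Finset ℕ+) (S : L2Unit) :
    inner ℝ (proj φ F S) S = ∑ j ∈ F, coeff φ S j ^ 2 := by
  simp only [proj, sum_inner, real_inner_smul_left, coeff, sq]

theorem hasSum_coeff_mul_coeff {θ : ℕ+ → ℝ} {S : L2Unit} (h : HasSum (fun j => θ j • φ j) S)
    (S' : L2Unit) : HasSum (fun j => θ j * coeff φ S' j) (inner ℝ S S') := by
  have h1 : HasSum (fun j => inner ℝ S' (θ j • φ j)) (inner ℝ S' S) := h.mapL (innerSL ℝ S')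
  rw [real_inner_comm]
  refine h1.congr_fun fun j => ?_
  rw [real_inner_smul_right, coeff, real_inner_comm]

variable (hφ : Orthonormal ℝ φ)

include hφ

theorem norm_proj_sq (F : Finset ℕ+) (S : L2Unit) :
    ‖proj φ F S‖ ^ 2 = ∑ j ∈ F, coeff φ S j ^ 2 := by
  rw [← real_inner_self_eq_norm_sq, proj, hφ.inner_sum]
  simp [sq]

theorem inner_proj_sub (F : Finset ℕ+) (S : L2Unit) :
    inner ℝ (proj φ F S) (S - proj φ F S) = 0 := by
  rw [inner_sub_right, inner_proj_left, real_inner_self_eq_norm_sq, norm_proj_sq hφ, sub_self]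

theorem norm_proj_le (F : Finset ℕ+) (S : L2Unit) : ‖proj φ F S‖ ≤ ‖S‖ := by
  refine le_of_sq_le_sq ?_ (norm_nonneg _)
  rw [norm_proj_sq hφ]
  exact ((summable_coeff_sq hφ S).sum_le_tsum F fun _ _ => sq_nonneg _).trans
    (tsum_coeff_sq_le hφ S)

/-- The tail beyond `l` vanishes when `l ≥ M`; when `l < M` the factor `l^{2s}` is at most `M^{2s}`
and the tail at most `‖S‖²`. -/
theorem proj_Iic_mem_besovBall {s P₀ : ℝ} (hs : 0 < s) (S : L2Unit) (M : ℕ+)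
    (h : (M : ℝ) ^ (2 * s) * ‖S‖ ^ 2 ≤ P₀) : proj φ (Finset.Iic M) S ∈ besovBall φ s P₀ := by
  refine ⟨fun j => if j ∈ Finset.Iic M then coeff φ S j else 0, ?_, fun l hl => ?_⟩
  · have h1 : proj φ (Finset.Iic M) S = ∑ j ∈ Finset.Iic M,
        (if j ∈ Finset.Iic M then coeff φ S j else 0) • φ j :=
      Finset.sum_congr rfl fun j hj => by rw [if_pos hj]
    rw [h1]
    exact hasSum_sum_of_ne_finset_zero fun j hj => by simp only [if_neg hj, zero_smul]
  · rcases le_or_gt (M : ℝ) l with hM | hM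
    · have h0 : ∀ j : ℕ+, (if l < (j : ℝ) then
          (if j ∈ Finset.Iic M then coeff φ S j else 0) ^ 2 else 0) = 0 := by
        intro j
        split_ifs with h1 h2
        · have h3 : ((j : ℕ) : ℝ) ≤ (M : ℕ) :=
            Nat.cast_le.2 (PNat.coe_le_coe _ _ |>.2 (Finset.mem_Iic.1 h2))
          linarith
        · simp
        · rfl
      simp only [h0, tsum_zero, mul_zero]
      exact le_trans (by positivity) h
    · refine le_trans ?_ h
      have h1 : ∀ j : ℕ+, (if l < (j : ℝ) then
          (if j ∈ Finset.Iic M then coeff φ S j else 0) ^ 2 else 0) ≤ coeff φ S j ^ 2 := by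
        intro j
        split_ifs
        · exact le_rfl
        · simpa using sq_nonneg _
        · exact sq_nonneg _
      have h0 : ∀ j : ℕ+, 0 ≤ (if l < (j : ℝ) then
          (if j ∈ Finset.Iic M then coeff φ S j else 0) ^ 2 else 0) := fun j => by
        split_ifs <;> positivity
      have hsum := summable_coeff_sq hφ S
      exact mul_le_mul (Real.rpow_le_rpow hl.le hM.le (by positivity))
        (((Summable.of_nonneg_of_le h0 h1 hsum).tsum_le_tsum h1 hsum).trans
          (tsum_coeff_sq_le hφ S)) (tsum_nonneg h0) (by positivity)

theorem coeff_eq_of_hasSum {θ : ℕ+ → ℝ} {S : L2Unit} (h : HasSum (fun j => θ j • φ j) S) :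
    coeff φ S = θ := by
  funext i
  have h1 : HasSum (fun j => inner ℝ (φ i) (θ j • φ j)) (coeff φ S i) :=
    h.mapL (innerSL ℝ (φ i))
  have h2 : HasSum (fun j => inner ℝ (φ i) (θ j • φ j)) (θ i) := by
    have h3 : ∀ j, j ≠ i → inner ℝ (φ i) (θ j • φ j) = 0 := fun j hj => by
      rw [real_inner_smul_right, hφ.inner_eq_zero hj.symm, mul_zero]
    have h4 := hasSum_single i h3
    rwa [real_inner_smul_right, real_inner_self_eq_norm_sq, hφ.norm_eq_one, one_pow, mul_one] at h4
  exact h1.unique h2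

end projection

/-! ### The cutoff frequency -/

/-- The index `[B k_ε]`. -/
noncomputable def cutoff (w : ℝ → ℕ → ℝ) (B ε : ℝ) : ℕ+ := Nat.toPNat' ⌊B * (kIdx w ε : ℝ)⌋₊

section cutoff

variable {w : ℝ → ℕ → ℝ} (hw : Conditions w) {B ε : ℝ} (hB : 1 < B) (hε : 0 < ε)

include hw hB hε

theorem one_le_mul_kIdx : 1 ≤ B * (kIdx w ε : ℝ) := by
  have h : (1 : ℝ) ≤ kIdx w ε := by exact_mod_cast hw.one_le_kIdx hε
  nlinarith

theorem coe_cutoff : (cutoff w B ε : ℕ) = ⌊B * (kIdx w ε : ℝ)⌋₊ := by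
  rw [cutoff, Nat.toPNat'_coe, if_pos (Nat.floor_pos.2 (one_le_mul_kIdx hw hB hε))]

theorem cutoff_le : (cutoff w B ε : ℝ) ≤ B * kIdx w ε := by
  rw [coe_cutoff hw hB hε]
  exact Nat.floor_le (by linarith [one_le_mul_kIdx hw hB hε])

theorem le_cutoff : B * kIdx w ε / 2 ≤ (cutoff w B ε : ℝ) := by
  have h1 : (1 : ℝ) ≤ (cutoff w B ε : ℕ) := by exact_mod_cast (cutoff w B ε).2
  have h2 := (Nat.lt_floor_add_one (B * (kIdx w ε : ℝ))).le
  rw [← coe_cutoff hw hB hε] at h2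
  linarith

end cutoff

/-! ### Large signal versus a component in the Besov ball -/

section signal

variable {φ : ℕ+ → L2Unit} (hφ : Orthonormal ℝ φ) {w : ℝ → ℕ → ℝ} (hw : Conditions w)
  {κ E R X : ℝ → ℝ} {s : ℝ} (hs : 0 < s)
  (hκ : ∀ ε > 0, 0 < κ ε) (hE : ∀ ε > 0, 0 < E ε) (hX : ∀ ε > 0, 0 < X ε)
  (hEκ : ∀ ε > 0, E ε ^ 2 * κ ε = ε ^ 4) (hRE : ∀ ε > 0, R ε * ε ^ 4 = E ε * X ε ^ 2)
  (hκX : ∀ ε > 0, κ ε ^ (2 * s) * X ε ^ 2 = 1)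
  (hk : (fun ε => (kIdx w ε : ℝ)) =Θ[𝓝[>] 0] κ)
  {S : ℝ → L2Unit} (hS : (fun ε => ‖S ε‖) =Θ[𝓝[>] 0] X)

include hφ hw in
theorem tsum_sq_mul_coeff_sq_le {ε η : ℝ} (hε : 0 < ε) (hη : 0 ≤ η) (M : ℕ+)
    (h : ∀ j : ℕ+, M < j → w ε j ^ 2 ≤ η) (S : L2Unit) :
    ∑' j : ℕ+, w ε j ^ 2 * coeff φ S j ^ 2 ≤
      w ε 1 ^ 2 * ‖proj φ (Finset.Iic M) S‖ ^ 2 + η * ‖S‖ ^ 2 := by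
  have hsum := summable_coeff_sq hφ S
  have h1 : HasSum (fun j => if j ∈ Finset.Iic M then coeff φ S j ^ 2 else 0)
      (‖proj φ (Finset.Iic M) S‖ ^ 2) := by
    have h0 : ‖proj φ (Finset.Iic M) S‖ ^ 2 =
        ∑ j ∈ Finset.Iic M, if j ∈ Finset.Iic M then coeff φ S j ^ 2 else 0 := by
      rw [norm_proj_sq hφ]
      exact Finset.sum_congr rfl fun j hj => (if_pos hj).symm
    rw [h0]
    exact hasSum_sum_of_ne_finset_zero fun j hj => if_neg hj
  calc ∑' j : ℕ+, w ε j ^ 2 * coeff φ S j ^ 2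
      ≤ ∑' j : ℕ+, (w ε 1 ^ 2 * (if j ∈ Finset.Iic M then coeff φ S j ^ 2 else 0) +
          η * coeff φ S j ^ 2) := by
        refine (hw.summable_sq_mul_sq hε hsum).tsum_le_tsum (fun j => ?_)
          ((h1.summable.mul_left _).add (hsum.mul_left _))
        split_ifs with hj
        · exact (mul_le_mul_of_nonneg_right (hw.sq_le_first hε j) (sq_nonneg _)).trans
            (le_add_of_nonneg_right (by positivity))
        · rw [mul_zero, zero_add]
          exact mul_le_mul_of_nonneg_right (h j (not_le.1 fun h => hj (Finset.mem_Iic.2 h)))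
            (sq_nonneg _)
    _ = w ε 1 ^ 2 * ‖proj φ (Finset.Iic M) S‖ ^ 2 + η * ∑' j, coeff φ S j ^ 2 := by
        rw [Summable.tsum_add (h1.summable.mul_left _) (hsum.mul_left _), tsum_mul_left,
          tsum_mul_left, h1.tsum_eq]
    _ ≤ _ := by
        gcongr
        exact tsum_coeff_sq_le hφ S

theorem norm_sq_eq_of_inner_eq_zero {S₁ S : L2Unit} (h : inner ℝ S₁ (S - S₁) = 0) :
    ‖S‖ ^ 2 = ‖S₁‖ ^ 2 + ‖S - S₁‖ ^ 2 := by
  have h1 := norm_add_sq_real S₁ (S - S₁)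
  rw [add_sub_cancel, h] at h1
  linarith

include hφ hw hs hκ hE hX hEκ hRE hκX hk hS in
theorem exists_decomposition_of_signal {c : ℝ} (hc : 0 < c)
    (hD : ∀ᶠ ε in 𝓝[>] 0,
      c * R ε ≤ (∑' j : ℕ+, w ε j ^ 2 * coeff φ (S ε) j ^ 2) / ε ^ 4) :
    ∃ P₀ : ℝ, 0 < P₀ ∧ ∃ S₁ : ℝ → L2Unit,
      (∀ ε > 0, S₁ ε ∈ besovBall φ s P₀) ∧ ((fun ε => ‖S₁ ε‖) =Θ[𝓝[>] 0] X) ∧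
      ∀ ε > 0, inner ℝ (S₁ ε) (S ε - S₁ ε) = 0 ∧
        ‖S ε‖ ^ 2 = ‖S₁ ε‖ ^ 2 + ‖S ε - S₁ ε‖ ^ 2 := by
  obtain ⟨a, ha, b, hb, hab⟩ := hw.exists_weight_bounds hκ hE hEκ hk
  obtain ⟨q, hq, hkq⟩ := hk.1.exists_pos
  obtain ⟨m, hm, hSm⟩ := hS.1.exists_pos
  obtain ⟨C₁, hC₁, lam, hlam, hA3⟩ := hw.A3
  -- By A3 the weights beyond `B k_ε` are at most `C₁ B^{-λ} b E`. This `B` makes their share of the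
  -- signal at most half of the lower bound `c E X²`.
  have hBev : ∀ᶠ B : ℝ in atTop, C₁ * B ^ (-lam) * b * m ^ 2 < c / 2 := by
    have h := (((tendsto_rpow_neg_atTop (zero_lt_one.trans hlam)).const_mul C₁).mul_const
      b).mul_const (m ^ 2)
    simp only [mul_zero, zero_mul] at h
    exact h.eventually (gt_mem_nhds (by positivity))
  obtain ⟨B, hB, hB1⟩ := (hBev.and (eventually_gt_atTop 1)).exists
  have hB₀ : 0 < B := by linarith
  set P₀ : ℝ := (B * q) ^ (2 * s) * m ^ 2 with hP₀
  have hP₀pos : 0 < P₀ := by positivity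
  classical
  -- Ball membership is required for every `ε > 0`, but the estimates hold only for small `ε`;
  -- elsewhere the zero function serves.
  set S₁ : ℝ → L2Unit := fun ε =>
    if (cutoff w B ε : ℝ) ^ (2 * s) * ‖S ε‖ ^ 2 ≤ P₀ then
      proj φ (Finset.Iic (cutoff w B ε)) (S ε) else 0 with hS₁
  have hnorm : ∀ᶠ ε in 𝓝[>] 0, ‖S ε‖ ≤ m * X ε := by
    filter_upwards [hSm.bound, self_mem_nhdsWithin] with ε h1 hε
    rwa [norm_norm, Real.norm_of_nonneg (hX ε hε).le] at h1
  have hS₁ev : ∀ᶠ ε in 𝓝[>] 0, S₁ ε = proj φ (Finset.Iic (cutoff w B ε)) (S ε) := by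
    filter_upwards [hkq.bound, hnorm, self_mem_nhdsWithin] with ε h1 h2 hε
    replace hε : 0 < ε := hε
    have hκε := hκ ε hε
    refine if_pos ?_
    rw [Real.norm_of_nonneg (Nat.cast_nonneg _), Real.norm_of_nonneg hκε.le] at h1
    have h3 : (cutoff w B ε : ℝ) ≤ B * q * κ ε := by
      rw [mul_assoc]
      exact (cutoff_le hw hB1 hε).trans (mul_le_mul_of_nonneg_left h1 hB₀.le)
    calc (cutoff w B ε : ℝ) ^ (2 * s) * ‖S ε‖ ^ 2
        ≤ (B * q * κ ε) ^ (2 * s) * (m * X ε) ^ 2 := by gcongr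
      _ = P₀ * (κ ε ^ (2 * s) * X ε ^ 2) := by
          rw [Real.mul_rpow (by positivity) hκε.le, hP₀]
          ring
      _ = P₀ := by rw [hκX ε hε, mul_one]
  refine ⟨P₀, hP₀pos, S₁, fun ε _ => ?_, ⟨?_, ?_⟩, fun ε _ => ?_⟩
  · simp only [hS₁]
    split_ifs with h
    · exact proj_Iic_mem_besovBall hφ hs _ _ h
    · refine ⟨0, by simp, fun l _ => ?_⟩
      simpa using hP₀pos.le
  · refine IsBigO.of_bound m ?_
    filter_upwards [hS₁ev, hnorm, self_mem_nhdsWithin] with ε h1 h2 hε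
    rw [norm_norm, Real.norm_of_nonneg (hX ε hε).le, h1]
    exact (norm_proj_le hφ _ _).trans h2
  · refine IsBigO.of_bound (√(c / (2 * b)))⁻¹ ?_
    filter_upwards [hS₁ev, hnorm, hD, hab, self_mem_nhdsWithin] with ε h1 h2 h3 h4 hε
    replace hε : 0 < ε := hε
    have hEε := hE ε hε
    have hXε := hX ε hε
    rw [norm_norm, Real.norm_of_nonneg hXε.le, h1, ← div_eq_inv_mul,
      le_div_iff₀ (by positivity)]
    refine le_of_sq_le_sq ?_ (norm_nonneg _)
    rw [mul_pow, Real.sq_sqrt (by positivity)]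
    have htail : ∀ j : ℕ+, cutoff w B ε < j → w ε j ^ 2 ≤ C₁ * B ^ (-lam) * (b * E ε) := by
      intro j hj
      have h5 := hA3 (B - 1) (by linarith) ε hε
      rw [add_sub_cancel, ← coe_cutoff hw hB1 hε] at h5
      refine (hw.sq_antitone hε (cutoff w B ε).2 (PNat.coe_le_coe _ _ |>.2 hj.le)).trans
        (h5.le.trans ?_)
      gcongr
      exact (hw.kappaSq_le_first hε).trans h4.2
    have h6 := tsum_sq_mul_coeff_sq_le hφ hw hε (by positivity) (cutoff w B ε) htail (S ε)
    rw [le_div_iff₀ (by positivity), mul_assoc, hRE ε hε] at h3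
    have h7 : C₁ * B ^ (-lam) * (b * E ε) * ‖S ε‖ ^ 2 ≤ c / 2 * (E ε * X ε ^ 2) := by
      calc _ ≤ C₁ * B ^ (-lam) * (b * E ε) * (m * X ε) ^ 2 := by gcongr
        _ = C₁ * B ^ (-lam) * b * m ^ 2 * (E ε * X ε ^ 2) := by ring
        _ ≤ _ := by gcongr
    have h8 : w ε 1 ^ 2 * ‖proj φ (Finset.Iic (cutoff w B ε)) (S ε)‖ ^ 2 ≤
        b * E ε * ‖proj φ (Finset.Iic (cutoff w B ε)) (S ε)‖ ^ 2 := by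
      gcongr
      exact h4.2
    have h9 : E ε * (c / 2 * X ε ^ 2) ≤
        E ε * (b * ‖proj φ (Finset.Iic (cutoff w B ε)) (S ε)‖ ^ 2) := by linarith
    have h10 := le_of_mul_le_mul_left h9 hEε
    rw [← div_div, ← mul_div_assoc, div_le_iff₀ hb]
    linarith
  · have h0 : inner ℝ (S₁ ε) (S ε - S₁ ε) = 0 := by
      simp only [hS₁]
      split_ifs
      · exact inner_proj_sub hφ _ _
      · simp
    exact ⟨h0, norm_sq_eq_of_inner_eq_zero h0⟩

include hφ in
/-- If `S₁` is orthogonal to `S - S₁` and has a small tail, then the first coefficients of `S`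
are not small. -/
theorem norm_sq_le_of_inner_eq_zero {S₁ S : L2Unit} (h0 : inner ℝ S₁ (S - S₁) = 0) {θ : ℕ+ → ℝ}
    (hθ : HasSum (fun j => θ j • φ j) S₁) {h : ℝ} (hh : 0 < h) (M : ℝ) :
    ‖S₁‖ ^ 2 ≤ ∑' j : ℕ+, (if (j : ℝ) ≤ M then coeff φ S j ^ 2 else 0) + ‖S‖ ^ 2 / h +
      h * ∑' j : ℕ+, (if M < (j : ℝ) then θ j ^ 2 else 0) := by
  have hηS : HasSum (fun j => θ j * coeff φ S j) (‖S₁‖ ^ 2) := by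
    have h1 : inner ℝ S₁ S = ‖S₁‖ ^ 2 := by
      rw [inner_sub_right, real_inner_self_eq_norm_sq] at h0
      linarith
    rw [← h1]
    exact hasSum_coeff_mul_coeff hθ S
  have hηη : HasSum (fun j => θ j ^ 2) (‖S₁‖ ^ 2) := by
    have h1 := hasSum_coeff_mul_coeff hθ S₁
    rw [real_inner_self_eq_norm_sq, coeff_eq_of_hasSum hφ hθ] at h1
    exact h1.congr_fun fun j => sq _
  have hSS := summable_coeff_sq hφ S
  have hhead : Summable fun j : ℕ+ => if (j : ℝ) ≤ M then coeff φ S j ^ 2 else 0 :=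
    Summable.of_nonneg_of_le (fun j => by split_ifs <;> positivity)
      (fun j => by split_ifs; exacts [le_rfl, sq_nonneg _]) hSS
  have htail : Summable fun j : ℕ+ => if M < (j : ℝ) then θ j ^ 2 else 0 :=
    Summable.of_nonneg_of_le (fun j => by split_ifs <;> positivity)
      (fun j => by split_ifs; exacts [le_rfl, sq_nonneg _]) hηη.summable
  -- Termwise, `θ_j c_j`, with `c_j` the coefficient of `S`, is at most `(θ_j² + c_j²) / 2` up to
  -- `M` and at most `(c_j² / h + h θ_j²) / 2` beyond it. After summation `‖S₁‖² / 2` is absorbed on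
  -- the left.
  have hle := hasSum_le (fun j => ?_) hηS (((hηη.add hhead.hasSum).add
    ((hSS.hasSum.div_const h).add (htail.hasSum.mul_left h))).div_const 2)
  · have h2 : (∑' j, coeff φ S j ^ 2) / h ≤ ‖S‖ ^ 2 / h :=
      div_le_div_of_nonneg_right (tsum_coeff_sq_le hφ S) hh.le
    linarith
  · rcases le_or_gt (j : ℝ) M with hj | hj
    · rw [if_pos hj, if_neg hj.not_gt, mul_zero, add_zero]
      have : 0 ≤ coeff φ S j ^ 2 / h := by positivity
      nlinarith [sq_nonneg (θ j - coeff φ S j)]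
    · rw [if_pos hj, if_neg hj.not_ge, add_zero]
      have h3 : 0 ≤ (coeff φ S j / h - θ j) ^ 2 * h := by positivity
      have h4 : (coeff φ S j / h - θ j) ^ 2 * h =
          coeff φ S j ^ 2 / h + h * θ j ^ 2 - 2 * (θ j * coeff φ S j) := by
        field_simp
        ring
      nlinarith [sq_nonneg (θ j)]

include hφ hw in
theorem le_tsum_sq_mul_coeff_sq {ε η : ℝ} (hε : 0 < ε) (M : ℕ+) (hη : η ≤ w ε M ^ 2)
    (S : L2Unit) :
    η * ∑' j : ℕ+, (if (j : ℝ) ≤ M then coeff φ S j ^ 2 else 0) ≤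
      ∑' j : ℕ+, w ε j ^ 2 * coeff φ S j ^ 2 := by
  have hSS := summable_coeff_sq hφ S
  have hhead : Summable fun j : ℕ+ => if (j : ℝ) ≤ M then coeff φ S j ^ 2 else 0 :=
    Summable.of_nonneg_of_le (fun j => by split_ifs <;> positivity)
      (fun j => by split_ifs; exacts [le_rfl, sq_nonneg _]) hSS
  rw [← tsum_mul_left]
  refine (hhead.mul_left _).tsum_le_tsum (fun j => ?_) (hw.summable_sq_mul_sq hε hSS)
  split_ifs with hj
  · exact mul_le_mul_of_nonneg_right
      (hη.trans (hw.sq_antitone hε j.2 (by exact_mod_cast hj))) (sq_nonneg _)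
  · rw [mul_zero]
    positivity

include hφ hw hs hκ hE hX hEκ hRE hκX hk hS in
theorem exists_signal_of_decomposition {P₀ : ℝ} {S₁ : ℝ → L2Unit}
    (hball : ∀ ε > 0, S₁ ε ∈ besovBall φ s P₀) (hS₁ : (fun ε => ‖S₁ ε‖) =Θ[𝓝[>] 0] X)
    (horth : ∀ ε > 0, inner ℝ (S₁ ε) (S ε - S₁ ε) = 0) :
    ∃ c > 0, ∀ᶠ ε in 𝓝[>] 0,
      c * R ε ≤ (∑' j : ℕ+, w ε j ^ 2 * coeff φ (S ε) j ^ 2) / ε ^ 4 := by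
  obtain ⟨a, ha, b, hb, hab⟩ := hw.exists_weight_bounds hκ hE hEκ hk
  obtain ⟨p, hp, hkp⟩ := hk.2.exists_pos
  obtain ⟨m, hm, hSm⟩ := hS.1.exists_pos
  obtain ⟨n, hn, hSn⟩ := hS₁.2.exists_pos
  -- Since `‖S‖ ≤ m X`, this makes `‖S‖² / h` at most a quarter of the lower bound `X² / n²` for
  -- `‖S₁‖²`. Then `B` is taken so large that the tail term is at most another quarter, and half
  -- remains for the low frequencies.
  set h : ℝ := 4 * m ^ 2 * n ^ 2 with hh
  have hh₀ : 0 < h := by positivity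
  have hBev : ∀ᶠ B : ℝ in atTop, h * P₀ * (B / (2 * p)) ^ (-(2 * s)) < 1 / (4 * n ^ 2) := by
    have h1 := ((tendsto_rpow_neg_atTop (show 0 < 2 * s by positivity)).comp
      (tendsto_id.atTop_div_const (show 0 < 2 * p by positivity))).const_mul (h * P₀)
    rw [mul_zero] at h1
    exact h1.eventually (gt_mem_nhds (by positivity))
  obtain ⟨B, hB, hB1⟩ := (hBev.and (eventually_gt_atTop 1)).exists
  have hB₀ : 0 < B := by linarith
  obtain ⟨C, hC, hA4⟩ := hw.A4_tail B hB1
  refine ⟨C * a / (2 * n ^ 2), by positivity, ?_⟩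
  filter_upwards [hkp.bound, hSm.bound, hSn.bound, hab, self_mem_nhdsWithin] with ε h1 h2 h3 h4 hε
  replace hε : 0 < ε := hε
  have hEε := hE ε hε
  have hXε := hX ε hε
  have hκε := hκ ε hε
  rw [Real.norm_of_nonneg (Nat.cast_nonneg _), Real.norm_of_nonneg hκε.le] at h1
  rw [norm_norm, Real.norm_of_nonneg hXε.le] at h2 h3
  set M := cutoff w B ε with hM
  obtain ⟨θ, hθ, hθP⟩ := hball ε hε
  have hMpos : (0 : ℝ) < M := by exact_mod_cast M.2
  have h5 := norm_sq_le_of_inner_eq_zero hφ (horth ε hε) hθ hh₀ M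
  have hMlow : B / (2 * p) * κ ε ≤ (M : ℝ) := by
    refine le_trans ?_ (le_cutoff hw hB1 hε)
    rw [div_mul_eq_mul_div, div_le_div_iff₀ (by positivity) two_pos]
    nlinarith [mul_le_mul_of_nonneg_left h1 hB₀.le]
  set T := ∑' j : ℕ+, (if (M : ℝ) < (j : ℝ) then θ j ^ 2 else 0) with hT
  have hT₀ : 0 ≤ T := tsum_nonneg fun j => by split_ifs <;> positivity
  have hTle : h * T ≤ 1 / (4 * n ^ 2) * X ε ^ 2 := by
    have h6 : (B / (2 * p)) ^ (2 * s) * κ ε ^ (2 * s) * T ≤ P₀ := by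
      refine le_trans (mul_le_mul_of_nonneg_right ?_ hT₀) (hθP M hMpos)
      rw [← Real.mul_rpow (by positivity) hκε.le]
      exact Real.rpow_le_rpow (by positivity) hMlow (by positivity)
    have h7 : (B / (2 * p)) ^ (-(2 * s)) * (B / (2 * p)) ^ (2 * s) = 1 := by
      rw [← Real.rpow_add (by positivity), neg_add_cancel, Real.rpow_zero]
    calc h * T = h * (B / (2 * p)) ^ (-(2 * s)) *
          ((B / (2 * p)) ^ (2 * s) * κ ε ^ (2 * s) * T) * X ε ^ 2 := by
          have h8 := hκX ε hε
          linear_combination (-(h * T)) * (κ ε ^ (2 * s) * X ε ^ 2) * h7 - h * T * h8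
      _ ≤ h * (B / (2 * p)) ^ (-(2 * s)) * P₀ * X ε ^ 2 := by gcongr
      _ = h * P₀ * (B / (2 * p)) ^ (-(2 * s)) * X ε ^ 2 := by ring
      _ ≤ _ := by gcongr
  have hSle : ‖S ε‖ ^ 2 / h ≤ 1 / (4 * n ^ 2) * X ε ^ 2 := by
    calc ‖S ε‖ ^ 2 / h ≤ (m * X ε) ^ 2 / h := by gcongr
      _ = _ := by rw [hh]; field_simp
  have hS₁ge : 1 / n ^ 2 * X ε ^ 2 ≤ ‖S₁ ε‖ ^ 2 := by
    rw [div_mul_eq_mul_div, one_mul, div_le_iff₀ (by positivity), mul_comm, ← mul_pow]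
    exact pow_le_pow_left₀ hXε.le h3 2
  have hhead : 1 / (2 * n ^ 2) * X ε ^ 2 ≤
      ∑' j : ℕ+, (if (j : ℝ) ≤ M then coeff φ (S ε) j ^ 2 else 0) := by
    have h9 : 1 / n ^ 2 * X ε ^ 2 - 1 / (4 * n ^ 2) * X ε ^ 2 - 1 / (4 * n ^ 2) * X ε ^ 2 =
        1 / (2 * n ^ 2) * X ε ^ 2 := by
      field_simp
      ring
    linarith
  have hwM : C * kappaSq w ε ≤ w ε M ^ 2 := by
    rw [hM, coe_cutoff hw hB1 hε]
    exact hA4 ε hε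
  rw [le_div_iff₀ (by positivity), mul_assoc, hRE ε hε]
  calc C * a / (2 * n ^ 2) * (E ε * X ε ^ 2)
      = C * (a * E ε) * (1 / (2 * n ^ 2) * X ε ^ 2) := by ring
    _ ≤ C * kappaSq w ε * ∑' j : ℕ+, (if (j : ℝ) ≤ M then coeff φ (S ε) j ^ 2 else 0) := by
        have := h4.1
        have h10 : 0 ≤ kappaSq w ε := sq_nonneg _
        gcongr
    _ ≤ _ := le_tsum_sq_mul_coeff_sq hφ hw hε M hwM (S ε)

end signal

end WhiteNoise

/-! ### The exponents: `κ = ε^{-4+8r+4ω}`, `E = ε^{4-4r-2ω}`, `R = ε^{-2ω}`, `X = ε^{2r}` -/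

theorem mainTheorem3
    (φ : ℕ+ → L2Unit) (hφ : Orthonormal ℝ φ)
    (w : ℝ → ℕ → ℝ) (hw : WhiteNoise.Conditions w)
    (r ω : ℝ) (hr₀ : 0 < r) (hr₁ : r < 1 / 2) (hω₀ : 0 < 2 * ω) (hω₁ : 2 * ω < 1 - 2 * r)
    (hk : (fun ε : ℝ => (WhiteNoise.kIdx w ε : ℝ)) =Θ[𝓝[>] 0]
      fun ε : ℝ => ε ^ (-4 + 8 * r + 4 * ω))
    (S : ℝ → L2Unit) (hS : (fun ε : ℝ => ‖S ε‖) =Θ[𝓝[>] 0] fun ε : ℝ => ε ^ (2 * r)) :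
    WhiteNoise.LDConsistent φ w (fun ε : ℝ => ε ^ (-2 * ω)) S ↔
      ∃ P₀ : ℝ, 0 < P₀ ∧ ∃ S₁ : ℝ → L2Unit,
        (∀ ε > 0, S₁ ε ∈ WhiteNoise.besovBall φ (r / (2 - 4 * r - 2 * ω)) P₀) ∧
        ((fun ε : ℝ => ‖S₁ ε‖) =Θ[𝓝[>] 0] fun ε : ℝ => ε ^ (2 * r)) ∧
        ∀ ε > 0, inner ℝ (S₁ ε) (S ε - S₁ ε) = 0 ∧
          ‖S ε‖ ^ 2 = ‖S₁ ε‖ ^ 2 + ‖S ε - S₁ ε‖ ^ 2 := by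
  have hden : 0 < 2 - 4 * r - 2 * ω := by linarith
  have hpow : ∀ p : ℝ, ∀ ε > 0, 0 < (fun ε : ℝ => ε ^ p) ε := fun p ε hε =>
    Real.rpow_pos_of_pos hε p
  have hEκ : ∀ ε > (0 : ℝ), (ε ^ (4 - 4 * r - 2 * ω)) ^ 2 * ε ^ (-4 + 8 * r + 4 * ω) = ε ^ 4 := by
    intro ε hε
    rw [← Real.rpow_natCast, ← Real.rpow_mul hε.le, ← Real.rpow_add hε, ← Real.rpow_natCast ε 4]
    congr 1
    push_cast
    ring
  have hRE : ∀ ε > (0 : ℝ),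
      ε ^ (-2 * ω) * ε ^ 4 = ε ^ (4 - 4 * r - 2 * ω) * (ε ^ (2 * r)) ^ 2 := by
    intro ε hε
    rw [← Real.rpow_natCast (ε ^ (2 * r)), ← Real.rpow_mul hε.le, ← Real.rpow_add hε,
      ← Real.rpow_natCast ε 4, ← Real.rpow_add hε]
    congr 1
    push_cast
    ring
  have hκX : ∀ ε > (0 : ℝ), (ε ^ (-4 + 8 * r + 4 * ω)) ^ (2 * (r / (2 - 4 * r - 2 * ω))) *
      (ε ^ (2 * r)) ^ 2 = 1 := by
    intro ε hε
    rw [← Real.rpow_natCast, ← Real.rpow_mul hε.le, ← Real.rpow_mul hε.le, ← Real.rpow_add hε,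
      ← Real.rpow_zero ε]
    have hdiv : r / (2 - 4 * r - 2 * ω) * (2 - 4 * r - 2 * ω) = r := div_mul_cancel₀ r hden.ne'
    congr 1
    push_cast
    linear_combination (-4) * hdiv
  have hR : Tendsto (fun ε : ℝ => ε ^ (-2 * ω)) (𝓝[>] 0) atTop :=
    tendsto_rpow_neg_nhdsGT_zero (by linarith)
  -- Here `u_1 R` is at most of order `ε^{2-4r-4ω}`, and `2ω < 1 - 2r` says exactly that this
  -- exponent is positive.
  have huR : Tendsto (fun ε : ℝ => w ε 1 ^ 2 / ε ^ 2 * ε ^ (-2 * ω)) (𝓝[>] 0) (𝓝 0) := by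
    obtain ⟨a, -, b, -, hab⟩ := hw.exists_weight_bounds (hpow _) (hpow _) hEκ hk
    have hlim : Tendsto (fun ε : ℝ => b * ε ^ (2 - 4 * r - 4 * ω)) (𝓝[>] 0) (𝓝 0) := by
      have h : Tendsto (fun ε : ℝ => ε ^ (2 - 4 * r - 4 * ω)) (𝓝 0) (𝓝 0) := by
        have h1 := (Real.continuousAt_rpow_const 0 (2 - 4 * r - 4 * ω)
          (Or.inr (by linarith))).tendsto
        rwa [Real.zero_rpow (by linarith)] at h1
      simpa using (h.mono_left nhdsWithin_le_nhds).const_mul b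
    refine squeeze_zero' ?_ ?_ hlim
    · filter_upwards [self_mem_nhdsWithin] with ε hε
      have := hpow (-2 * ω) ε hε
      positivity
    · filter_upwards [hab, self_mem_nhdsWithin] with ε h hε
      replace hε : 0 < ε := hε
      have h1 : ε ^ (4 - 4 * r - 2 * ω) / ε ^ 2 * ε ^ (-2 * ω) = ε ^ (2 - 4 * r - 4 * ω) := by
        rw [← Real.rpow_natCast ε 2, ← Real.rpow_sub hε, ← Real.rpow_add hε]
        congr 1
        push_cast
        ring
      have := hpow (-2 * ω) ε hε
      rw [← h1, ← mul_assoc, ← mul_div_assoc]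
      gcongr
      exact h.2
  rw [WhiteNoise.ldConsistent_iff_signal hφ hw (hpow _) hR huR S]
  constructor
  · rintro ⟨c, hc, hD⟩
    exact WhiteNoise.exists_decomposition_of_signal hφ hw (div_pos hr₀ hden) (hpow _) (hpow _)
      (hpow _) hEκ hRE hκX hk hS hc hD
  · rintro ⟨P₀, -, S₁, hball, hS₁, horth⟩
    exact WhiteNoise.exists_signal_of_decomposition hφ hw (div_pos hr₀ hden) (hpow _) (hpow _)
      (hpow _) hEκ hRE hκX hk hS hball hS₁ fun ε hε => (horth ε hε).1
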